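/- Let $d\ge 1$, $\ell\ge 2$, $\beta_2>0$ and $\sigma$ be given. There is a constant $C$, depending only on $d,\ell,\beta_2,\sigma$, such that the following holds for every $s\in[0,1]$, every bounded polytopal domain $\Omega\subset\mathbb{R}^d$ (with $\Omega$ equal to the interior of $\overline\Omega$), every conforming partition $\mathcal T$ of $\overline\Omega$ into finitely many closed $d$-simplices that is shape regular with constant $\sigma$, i.e. $\operatorname{diam} T\le\sigma |T|^{1/d}$ for all $T\in\mathcal T$ (and, if $d=1$, satisfies $h_T\le \sigma h_{T'}$ whenever $T\cap T'\neq\emptyset$), and every $\gamma\subset\partial\Omega$ that is a (possibly empty) union of $(d-1)$-faces of simplices $T\in\mathcal T$. Write $h_{\mathcal T}|_T=h_T:=|T|^{1/d}$. Let $H^1_{0,\gamma}(\Omega)$ be the closure in $H^1(\Omega)$ of the smooth functions on $\overline\Omega$ that vanish on $\gamma$, and let $\mathscr V_{\mathcal T}^2$ be the space of all continuous $u\in H^1_{0,\gamma}(\Omega)$ with $u|_T\in\mathcal P_\ell$ for all $T\in\mathcal T$, equipped with the norm $\|h_{\mathcal T}^{-s}\,\cdot\,\|_{L_2(\Omega)}$.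 Let $N^{0,\ell}_{\mathcal T}$ be the set of the canonical Lagrange points of degree $\ell$ not on $\gamma$, i.e. the points outside $\gamma$ that have barycentric coordinates in $\ell^{-1}\mathbb{N}_0$ with respect to some $T\in\mathcal T$. Then $\mathscr V_{\mathcal T}^2$ has a basis $\{\phi^\ell_\nu:\nu\in N^{0,\ell}_{\mathcal T}\}$ with $\phi^\ell_\nu(\nu')=\delta_{\nu\nu'}$ for $\nu,\nu'\in N^{0,\ell}_{\mathcal T}$, and the operator $R_{\mathcal T}:\mathscr V_{\mathcal T}^2\to(\mathscr V_{\mathcal T}^2)'$, $$(R_{\mathcal T}u)(w):=\beta_2^{-1}\sum_{\nu\in N^{0,\ell}_{\mathcal T}}\|h_{\mathcal T}^{-s}\phi^\ell_\nu\|^2_{L_2(\Omega)}\,u(\nu)\,w(\nu),$$ is boundedly invertible. Its inverse $G^2_{\mathcal T}:=R_{\mathcal T}^{-1}$ satisfies $G^2_{\mathcal T}\in\mathcal L\mathrm{is}_c((\mathscr V_{\mathcal T}^2)',\mathscr V_{\mathcal T}^2)$ uniformly: it is bounded, boundedly invertible and coercive, i.e. $\inf_{0\ne f\in(\mathscr V^2_{\mathcal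 T})'} f(G^2_{\mathcal T}f)/\|f\|^2_{(\mathscr V^2_{\mathcal T})'}>0$, and, with $\Re(G):=\frac12(G+G')$, $$\max\Big(\|G^2_{\mathcal T}\|_{\mathcal L((\mathscr V_{\mathcal T}^2)',\mathscr V_{\mathcal T}^2)},\ \|\Re(G^2_{\mathcal T})^{-1}\|_{\mathcal L(\mathscr V_{\mathcal T}^2,(\mathscr V_{\mathcal T}^2)')}\Big)\le C.$$ -/

import Mathlib

open MeasureTheory Set

noncomputable section

namespace FEM

/-! ### Operators in `Lis_c` with quantitative bounds -/

section Operators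

variable {Y : Type*} [SeminormedAddCommGroup Y] [NormedSpace ℝ Y]

/-- The real part `½ (C + C')` of a bounded operator `C : Y → Y'`; the adjoint `C'`, restricted to
`Y ⊆ Y''`, is `(C' y) z = (C z) y`. -/
def realPart (C : Y →L[ℝ] StrongDual ℝ Y) : Y →L[ℝ] StrongDual ℝ Y :=
  (1 / 2 : ℝ) • (C + C.flip)

/-- `C ∈ Lis_c(Y, Y')`: `C` is boundedly invertible and coercive. -/
def IsLisc (C : Y →L[ℝ] StrongDual ℝ Y) : Prop :=
  C.IsInvertible ∧ IsCoercive C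

/-- `C ∈ Lis_c(Y, Y')` with `max (‖C‖, ‖Re(C)⁻¹‖) ≤ K`. A family of operators is in `Lis_c` uniformly
iff all its members satisfy this with one and the same `K`. -/
def IsLiscWith (K : ℝ) (C : Y →L[ℝ] StrongDual ℝ Y) : Prop :=
  IsLisc C ∧ ‖C‖ ≤ K ∧ (realPart C).IsInvertible ∧ ‖(realPart C).inverse‖ ≤ K

/-- A bounded operator `G : Y' → Y` seen as an operator `Y' → (Y')'` through the canonical isometric
embedding `Y → Y''` (an isomorphism for reflexive, in particular finite dimensional, `Y`).
The statement `G ∈ Lis_c(Y', Y)` is about this operator. -/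
def toBidual (G : StrongDual ℝ Y →L[ℝ] Y) :
    StrongDual ℝ Y →L[ℝ] StrongDual ℝ (StrongDual ℝ Y) :=
  (NormedSpace.inclusionInDoubleDual ℝ Y).comp G

end Operators

/-! ### Domains and partitions -/

/-- `d`-dimensional Euclidean space. -/
abbrev Pt (d : ℕ) : Type := EuclideanSpace ℝ (Fin d)

/-- The closed convex hull of a finite set of points (a closed simplex if the points are affinely
independent). -/
def hull {d : ℕ} (S : Finset (Pt d)) : Set (Pt d) := convexHull ℝ (S : Set (Pt d))

/-- `h_T = |T|^{1/d}`, for `T` the convex hull of `S`. -/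
def cellSize {d : ℕ} (S : Finset (Pt d)) : ℝ := (volume.real (hull S)) ^ (1 / (d : ℝ))

/-- A bounded polytopal domain in `ℝ^d`. It lies nowhere on both sides of its boundary (no cracks):
it is the interior of its closure. -/
structure PolytopalDomain (d : ℕ) where
  carrier : Set (Pt d)
  isOpen : IsOpen carrier
  isConnected : IsConnected carrier
  isBounded : Bornology.IsBounded carrier
  interior_closure : interior (closure carrier) = carrier
  polytopal : ∃ P : Finset (Finset (Pt d)), closure carrier = ⋃ S ∈ P, hull S

/-- A conforming partition of (the closure of) `Ω` into finitely many closed `d`-simplices, each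
given by its set of `d + 1` vertices: the intersection of two simplices is the common face
spanned by their common vertices (possibly empty). -/
structure Triangulation {d : ℕ} (Ω : PolytopalDomain d) where
  cells : Finset (Finset (Pt d))
  card_eq : ∀ S ∈ cells, S.card = d + 1
  affineIndependent : ∀ S ∈ cells, AffineIndependent ℝ ((↑) : S → Pt d)
  conforming : ∀ S ∈ cells, ∀ S' ∈ cells,
    hull S ∩ hull S' ⊆ convexHull ℝ ((S : Set (Pt d)) ∩ (S' : Set (Pt d)))
  cover : ⋃ S ∈ cells, hull S = closure Ω.carrier

/-! ### Sobolev spaces -/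

/-- The pairs `(v|_Ω, ∇v|_Ω)` in `L₂(Ω) × L₂(Ω)^d`, for `v` a smooth function on `ℝ^d` that vanishes
on `γ`. Gradients are represented by the derivative, which has the same pointwise norm. -/
def smoothGraph {d : ℕ} (Ω : PolytopalDomain d) (γ : Set (Pt d)) :
    Submodule ℝ (Lp ℝ 2 (volume.restrict Ω.carrier) ×
      Lp (StrongDual ℝ (Pt d)) 2 (volume.restrict Ω.carrier)) where
  carrier := {p | ∃ v : Pt d → ℝ, ContDiff ℝ (⊤ : ℕ∞) v ∧ (∀ x ∈ γ, v x = 0) ∧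
    p.1 =ᵐ[volume.restrict Ω.carrier] v ∧ p.2 =ᵐ[volume.restrict Ω.carrier] fderiv ℝ v}
  zero_mem' := by
    refine ⟨0, contDiff_const, fun _ _ => rfl, Lp.coeFn_zero _ _ _, ?_⟩
    have h : fderiv ℝ (0 : Pt d → ℝ) = 0 := by ext1 x; simp
    rw [h]
    exact Lp.coeFn_zero _ _ _
  add_mem' := by
    rintro p q ⟨v, hv, hv0, hp1, hp2⟩ ⟨w, hw, hw0, hq1, hq2⟩
    refine ⟨v + w, hv.add hw, fun x hx => by simp [hv0 x hx, hw0 x hx], ?_, ?_⟩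
    · exact (Lp.coeFn_add _ _).trans (hp1.add hq1)
    · have h : fderiv ℝ (v + w) = fderiv ℝ v + fderiv ℝ w := by
        ext1 x
        exact fderiv_add (hv.differentiable (by simp) x) (hw.differentiable (by simp) x)
      rw [h]
      exact (Lp.coeFn_add _ _).trans (hp2.add hq2)
  smul_mem' := by
    rintro c p ⟨v, hv, hv0, hp1, hp2⟩
    refine ⟨c • v, contDiff_const.smul hv, fun x hx => by simp [hv0 x hx], ?_, ?_⟩
    · exact (Lp.coeFn_smul _ _).trans (hp1.const_smul c)
    · have h : fderiv ℝ (c • v) = c • fderiv ℝ v := by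
        ext1 x
        exact fderiv_const_smul (hv.differentiable (by simp) x) c
      rw [h]
      exact (Lp.coeFn_smul _ _).trans (hp2.const_smul c)

/-- `H¹_{0,γ}(Ω)`, the closure in `H¹(Ω)` of the smooth functions on the closure of `Ω` that vanish
on `γ`, as a subspace of `L₂(Ω)`: `u` belongs to it if there are smooth `v_k` vanishing on `γ`
with `v_k → u` in `L₂(Ω)` and `∇v_k → g` in `L₂(Ω)^d` for some `g` (which then is the weak
gradient of `u`). -/
def H10 {d : ℕ} (Ω : PolytopalDomain d) (γ : Set (Pt d)) :
    Submodule ℝ (Lp ℝ 2 (volume.restrict Ω.carrier)) :=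
  (smoothGraph Ω γ).topologicalClosure.map (LinearMap.fst ℝ _ _)

namespace Triangulation

variable {d : ℕ} {Ω : PolytopalDomain d} (T : Triangulation Ω)

/-- Shape regularity with constant `σ`: `diam T ≤ σ |T|^{1/d}` for all simplices `T`. -/
def ShapeRegular (σ : ℝ) : Prop :=
  ∀ S ∈ T.cells, Metric.diam (hull S) ≤ σ * cellSize S

/-- The `K`-mesh property with constant `σ`: simplices that touch have comparable sizes. -/
def KMesh (σ : ℝ) : Prop :=
  ∀ S ∈ T.cells, ∀ S' ∈ T.cells, (hull S ∩ hull S').Nonempty → cellSize S ≤ σ * cellSize S'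

/-- `γ` is a part of the boundary that is a (possibly empty) union of `(d-1)`-faces of simplices
of the partition. -/
def IsBoundaryPart (γ : Set (Pt d)) : Prop :=
  γ ⊆ frontier Ω.carrier ∧
    ∃ F : Finset (Finset (Pt d)), (∀ f ∈ F, f.card = d ∧ ∃ S ∈ T.cells, f ⊆ S) ∧
      γ = ⋃ f ∈ F, hull f

/-- The piecewise constant mesh-size function: `h = h_T` on the interior of each simplex `T`. (The
values on the union of the boundaries of the simplices, a null set, are irrelevant.) -/
def meshSize (x : Pt d) : ℝ :=
  ∑ S ∈ T.cells, (interior (hull S)).indicator (fun _ => cellSize S) x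

open Classical in
/-- The canonical Lagrange evaluation points of degree `ℓ` that are not on `γ`: the points with
barycentric coordinates in `ℓ⁻¹ ℕ` with respect to some simplex of the partition. -/
def lagrangeNodes (γ : Set (Pt d)) (ℓ : ℕ) : Finset (Pt d) :=
  (T.cells.biUnion fun S =>
    (Finset.piAntidiag S ℓ).image fun k => ∑ v ∈ S, ((k v : ℝ) / (ℓ : ℝ)) • v).filter (· ∉ γ)

/-- The space of continuous piecewise polynomials of degree `ℓ` in `H¹_{0,γ}(Ω)`. A function on the
closure of `Ω` is represented by its extension by zero to `ℝ^d`, so that point values are those of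
the continuous representative. -/
def feSpace (γ : Set (Pt d)) (ℓ : ℕ) : Submodule ℝ (Pt d → ℝ) where
  carrier := {u | ContinuousOn u (closure Ω.carrier) ∧ (∀ x ∉ closure Ω.carrier, u x = 0) ∧
    (∀ S ∈ T.cells, ∃ p : MvPolynomial (Fin d) ℝ, p.totalDegree ≤ ℓ ∧
      ∀ x ∈ hull S, u x = MvPolynomial.eval (fun i => x i) p) ∧
    ∃ f ∈ H10 Ω γ, f =ᵐ[volume.restrict Ω.carrier] u}
  zero_mem' := ⟨continuousOn_const, fun _ _ => rfl, fun _ _ => ⟨0, by simp, by simp⟩,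
    0, Submodule.zero_mem _, Lp.coeFn_zero _ _ _⟩
  add_mem' := by
    rintro u w ⟨hu, hu0, hup, f, hf, hfu⟩ ⟨hw, hw0, hwp, g, hg, hgw⟩
    refine ⟨hu.add hw, fun x hx => by simp [hu0 x hx, hw0 x hx], fun S hS => ?_,
      f + g, Submodule.add_mem _ hf hg, (Lp.coeFn_add _ _).trans (hfu.add hgw)⟩
    obtain ⟨p, hp, hpu⟩ := hup S hS
    obtain ⟨q, hq, hqw⟩ := hwp S hS
    exact ⟨p + q, (MvPolynomial.totalDegree_add p q).trans (max_le hp hq),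
      fun x hx => by simp [hpu x hx, hqw x hx]⟩
  smul_mem' := by
    rintro c u ⟨hu, hu0, hup, f, hf, hfu⟩
    refine ⟨hu.const_smul c, fun x hx => by simp [hu0 x hx], fun S hS => ?_,
      c • f, Submodule.smul_mem _ c hf, (Lp.coeFn_smul _ _).trans (hfu.const_smul c)⟩
    obtain ⟨p, hp, hpu⟩ := hup S hS
    exact ⟨c • p, (MvPolynomial.totalDegree_smul_le c p).trans hp,
      fun x hx => by simp [hpu x hx]⟩

/-! ### The scaled `L₂`-norm -/

theorem measurable_meshSize : Measurable T.meshSize :=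
  Finset.measurable_fun_sum _ fun _ _ =>
    measurable_const.indicator isOpen_interior.measurableSet

open Classical in
theorem finite_range_meshSize : (range T.meshSize).Finite := by
  refine ((T.cells.powerset.image fun A => ∑ S ∈ A, cellSize S).finite_toSet).subset ?_
  rintro _ ⟨x, rfl⟩
  simp only [Finset.coe_image, mem_image, Finset.mem_coe, Finset.mem_powerset]
  refine ⟨T.cells.filter fun S => x ∈ interior (hull S), Finset.filter_subset _ _, ?_⟩
  rw [Finset.sum_filter]
  rfl

theorem cellSize_nonneg (S : Finset (Pt d)) : 0 ≤ cellSize S :=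
  Real.rpow_nonneg measureReal_nonneg _

theorem cellSize_pos {S : Finset (Pt d)} {x : Pt d} (hx : x ∈ interior (hull S)) :
    0 < cellSize S := by
  refine Real.rpow_pos_of_pos (ENNReal.toReal_pos ?_ ?_) _
  · exact (Measure.measure_pos_of_nonempty_interior volume ⟨x, hx⟩).ne'
  · exact (S.finite_toSet.isCompact_convexHull ℝ).measure_lt_top.ne

theorem meshSize_pos_ae : ∀ᵐ x ∂(volume.restrict Ω.carrier), 0 < T.meshSize x := by
  have h0 : ∀ᵐ x ∂(volume.restrict Ω.carrier), ∀ S ∈ T.cells, x ∉ frontier (hull S) := by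
    refine ae_restrict_of_ae ?_
    rw [Finset.eventually_all]
    intro S _
    exact measure_eq_zero_iff_ae_notMem.1 ((convex_convexHull ℝ _).addHaar_frontier volume)
  filter_upwards [h0, ae_restrict_mem Ω.isOpen.measurableSet] with x hx hxΩ
  have h1 : x ∈ ⋃ S ∈ T.cells, hull S := T.cover ▸ subset_closure hxΩ
  simp only [mem_iUnion, exists_prop] at h1
  obtain ⟨S, hS, hxS⟩ := h1
  have hint : x ∈ interior (hull S) := by
    by_contra h
    exact hx S hS ⟨subset_closure hxS, h⟩
  refine Finset.sum_pos' (fun S' _ => indicator_nonneg (fun _ _ => cellSize_nonneg S') x)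
    ⟨S, hS, ?_⟩
  rw [indicator_of_mem hint]
  exact cellSize_pos hint

theorem memLp_scaled {γ : Set (Pt d)} {ℓ : ℕ} (s : ℝ) (u : T.feSpace γ ℓ) :
    MemLp (fun x => T.meshSize x ^ (-s) * u.1 x) 2 (volume.restrict Ω.carrier) := by
  have hc : IsCompact (closure Ω.carrier) := Ω.isBounded.isCompact_closure
  have : IsFiniteMeasure (volume.restrict Ω.carrier) :=
    ⟨by simpa using Ω.isBounded.measure_lt_top⟩
  obtain ⟨A, hA⟩ := hc.exists_bound_of_continuousOn u.2.1
  obtain ⟨B, hB⟩ := ((T.finite_range_meshSize.image fun t => ‖t ^ (-s)‖).bddAbove)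
  refine MemLp.of_bound (C := B * A) ?_ ?_
  · exact (T.measurable_meshSize.pow_const (-s)).aestronglyMeasurable.mul
      ((u.2.1.mono subset_closure).aestronglyMeasurable Ω.isOpen.measurableSet)
  · filter_upwards [ae_restrict_mem Ω.isOpen.measurableSet] with x hx
    have h1 : ‖T.meshSize x ^ (-s)‖ ≤ B := hB ⟨_, ⟨x, rfl⟩, rfl⟩
    rw [norm_mul]
    exact mul_le_mul h1 (hA x (subset_closure hx)) (norm_nonneg _) ((norm_nonneg _).trans h1)

/-- The finite element space as a type of its own, to be equipped with the norm
`‖h^{-s} · ‖_{L₂(Ω)}`. -/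
def V2 (γ : Set (Pt d)) (ℓ : ℕ) (_s : ℝ) : Type := T.feSpace γ ℓ

namespace V2

variable {T} {γ : Set (Pt d)} {ℓ : ℕ} {s : ℝ}

instance : AddCommGroup (T.V2 γ ℓ s) := inferInstanceAs (AddCommGroup (T.feSpace γ ℓ))

instance : Module ℝ (T.V2 γ ℓ s) := inferInstanceAs (Module ℝ (T.feSpace γ ℓ))

/-- Elements of the finite element space are functions; `u ν` is the value of `u` at `ν`. -/
instance : CoeFun (T.V2 γ ℓ s) fun _ => Pt d → ℝ := ⟨Subtype.val⟩

variable (T γ ℓ s) in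
/-- The map `u ↦ h^{-s} u` into `L₂(Ω)`. -/
def scaled : T.V2 γ ℓ s →ₗ[ℝ] Lp ℝ 2 (volume.restrict Ω.carrier) where
  toFun u := (T.memLp_scaled s u).toLp _
  map_add' u w := by
    rw [← MemLp.toLp_add]
    refine MemLp.toLp_congr _ _ (Filter.Eventually.of_forall fun x => ?_)
    exact mul_add _ _ _
  map_smul' c u := by
    rw [← MemLp.toLp_const_smul]
    refine MemLp.toLp_congr _ _ (Filter.Eventually.of_forall fun x => ?_)
    exact mul_left_comm _ _ _

theorem scaled_injective : Function.Injective (scaled T γ ℓ s) := by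
  refine (injective_iff_map_eq_zero _).2 fun u hu => ?_
  have h1 : (fun x => T.meshSize x ^ (-s) * u.1 x) =ᵐ[volume.restrict Ω.carrier] 0 := by
    have h2 := (T.memLp_scaled s u).coeFn_toLp
    have h3 : (T.memLp_scaled s u).toLp _ = 0 := hu
    rw [h3] at h2
    exact h2.symm.trans (Lp.coeFn_zero _ _ _)
  have h4 : u.1 =ᵐ[volume.restrict Ω.carrier] fun _ => 0 := by
    filter_upwards [h1, T.meshSize_pos_ae] with x hx hpos
    exact (mul_eq_zero.1 hx).resolve_left (Real.rpow_pos_of_pos hpos _).ne'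
  have h5 : EqOn u.1 (fun _ => 0) Ω.carrier :=
    Measure.eqOn_open_of_ae_eq h4 Ω.isOpen (u.2.1.mono subset_closure) continuousOn_const
  have h6 : EqOn u.1 (fun _ => 0) (closure Ω.carrier) :=
    h5.of_subset_closure u.2.1 continuousOn_const subset_closure subset_rfl
  refine Subtype.ext (funext fun x => ?_)
  by_cases hx : x ∈ closure Ω.carrier
  · exact h6 hx
  · exact u.2.2.1 x hx

/-- The norm `‖u‖ = ‖h^{-s} u‖_{L₂(Ω)}`. -/
instance : NormedAddCommGroup (T.V2 γ ℓ s) :=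
  NormedAddCommGroup.induced _ _ (scaled T γ ℓ s) scaled_injective

instance : NormedSpace ℝ (T.V2 γ ℓ s) :=
  NormedSpace.induced ℝ _ _ (scaled T γ ℓ s)

end V2

end Triangulation

end FEM

end

noncomputable section

namespace FEM

section

/-! ### Polynomial functions -/

/-! In the nodal basis, R is β₂⁻¹ times the diagonal form Σ ‖φ_ν‖² u(ν) w(ν). The bounds therefore
reduce to the equivalence of ‖u‖² and Σ ‖φ_ν‖² u(ν)², with a constant independent of the
triangulation and of s (`exists_nodal_norm_equiv`). The mesh size is constant on each simplex S, so
both quantities split into cell contributions carrying the same factor h_S^{-2s}, and on each cell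
both compare with |S| Σ u(ν)² over the nodes of S. That comparison (`exists_uniform_norm_equiv`) is
equivalence of norms in finite dimension on one reference simplex, carried to the others by affine
maps: integrals and volumes pick up the same determinant, so the constant survives. Symmetry and
Cauchy–Schwarz then turn bounds on R into bounds on its inverse (`isLiscWith_symm`).

The longer part is the existence of the basis, because H¹_{0,γ} is given as a closure of smooth
functions while the basis is described by point values. Unisolvence of the Lagrange points on
simplices and on their faces (`polyFun_eq_zero_of_nodes`) lets local interpolants be glued. The
glued function is Lipschitz on the closed domain (`exists_regularly_situated`); if it vanishes on γ,
it is extended, shrunk so as to vanish near γ, and mollified, hence lies in H¹_{0,γ}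
(`InH1.of_lipschitz`).

Conversely, a member of H¹_{0,γ} that is continuous up to the boundary vanishes on γ
(`eq_zero_on_of_mem_H10`): by Poincaré's inequality its mean over a slab of thickness ε above a face
is O(√ε). So the nodal values off γ determine the function. -/

theorem totalDegree_bind₁_le {σ τ : Type*} [Fintype σ] (g : σ → MvPolynomial τ ℝ)
    (hg : ∀ i, (g i).totalDegree ≤ 1) (p : MvPolynomial σ ℝ) :
    (MvPolynomial.bind₁ g p).totalDegree ≤ p.totalDegree := by
  rw [MvPolynomial.bind₁, MvPolynomial.aeval_def, MvPolynomial.eval₂_eq']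
  refine MvPolynomial.totalDegree_finsetSum_le fun m hm => ?_
  refine (MvPolynomial.totalDegree_mul _ _).trans ?_
  rw [MvPolynomial.algebraMap_eq, MvPolynomial.totalDegree_C, zero_add]
  refine (MvPolynomial.totalDegree_finsetProd _ _).trans ?_
  refine le_trans ?_ (MvPolynomial.le_totalDegree hm)
  rw [Finsupp.sum_fintype _ _ (fun _ => rfl)]
  refine Finset.sum_le_sum fun i _ => ?_
  refine (MvPolynomial.totalDegree_pow _ _).trans ?_
  exact (Nat.mul_le_mul_left _ (hg i)).trans (mul_one _).le

/-- The polynomial functions of degree at most `n` on `ℝ^d`. -/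
def polyFun (d n : ℕ) : Submodule ℝ (Pt d → ℝ) where
  carrier := {u | ∃ p : MvPolynomial (Fin d) ℝ, p.totalDegree ≤ n ∧
    ∀ x, u x = MvPolynomial.eval (fun i => x i) p}
  zero_mem' := ⟨0, by simp, by simp⟩
  add_mem' := by
    rintro u w ⟨p, hp, hpu⟩ ⟨q, hq, hqw⟩
    exact ⟨p + q, (MvPolynomial.totalDegree_add p q).trans (max_le hp hq),
      fun x => by simp [hpu x, hqw x]⟩
  smul_mem' := by
    rintro c u ⟨p, hp, hpu⟩
    exact ⟨c • p, (MvPolynomial.totalDegree_smul_le c p).trans hp, fun x => by simp [hpu x]⟩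

section polyFun

variable {d n m : ℕ}

theorem polyFun_mul {u w : Pt d → ℝ} (hu : u ∈ polyFun d n) (hw : w ∈ polyFun d m) :
    u * w ∈ polyFun d (n + m) := by
  obtain ⟨p, hp, hpu⟩ := hu
  obtain ⟨q, hq, hqw⟩ := hw
  exact ⟨p * q, (MvPolynomial.totalDegree_mul p q).trans (add_le_add hp hq),
    fun x => by simp [hpu x, hqw x]⟩

theorem polyFun_const (c : ℝ) : (fun _ : Pt d => c) ∈ polyFun d n :=
  ⟨MvPolynomial.C c, by simp, by simp⟩

theorem polyFun_prod {ι : Type*} (s : Finset ι) (u : ι → Pt d → ℝ) (e : ι → ℕ)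
    (hu : ∀ i ∈ s, u i ∈ polyFun d (e i)) : ∏ i ∈ s, u i ∈ polyFun d (∑ i ∈ s, e i) := by
  classical
  induction s using Finset.induction_on with
  | empty => simpa using! polyFun_const (d := d) (n := 0) 1
  | insert a s ha ih =>
    rw [Finset.prod_insert ha, Finset.sum_insert ha]
    exact polyFun_mul (hu a (Finset.mem_insert_self a s))
      (ih fun i hi => hu i (Finset.mem_insert_of_mem hi))

theorem polyFun_affine (a : Pt d →ᵃ[ℝ] ℝ) : (a : Pt d → ℝ) ∈ polyFun d 1 := by
  refine ⟨MvPolynomial.C (a 0) + ∑ i, MvPolynomial.C (a.linear (EuclideanSpace.single i 1)) *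
    MvPolynomial.X i, ?_, fun x => ?_⟩
  · refine (MvPolynomial.totalDegree_add _ _).trans (max_le (by simp) ?_)
    refine MvPolynomial.totalDegree_finsetSum_le fun i _ => ?_
    refine (MvPolynomial.totalDegree_mul _ _).trans ?_
    simp
  · have h1 : a x = a.linear x + a 0 := by
      have := a.map_vadd 0 x
      simpa using this
    have h2 : x = ∑ i, x i • EuclideanSpace.single i (1 : ℝ) := by
      have := (EuclideanSpace.basisFun (Fin d) ℝ).sum_repr x
      simpa using this.symm
    rw [h1, add_comm]
    conv_lhs => rw [h2]
    simp [mul_comm]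

theorem polyFun_comp_affine {u : Pt d → ℝ} (hu : u ∈ polyFun d n) (A : Pt d →ᵃ[ℝ] Pt d) :
    u ∘ A ∈ polyFun d n := by
  obtain ⟨p, hp, hpu⟩ := hu
  have h : ∀ i, ∃ q : MvPolynomial (Fin d) ℝ, q.totalDegree ≤ 1 ∧
      ∀ x : Pt d, (A x) i = MvPolynomial.eval (fun j => x j) q := fun i =>
    polyFun_affine ((EuclideanSpace.proj (𝕜 := ℝ) i).toLinearMap.toAffineMap.comp A)
  choose g hg hgA using h
  refine ⟨MvPolynomial.bind₁ g p, (totalDegree_bind₁_le g hg p).trans hp, fun x => ?_⟩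
  have e : (fun i => (A x) i) = fun i => MvPolynomial.eval (fun j => x j) (g i) :=
    funext fun i => hgA i x
  rw [Function.comp_apply, hpu, e]
  exact (MvPolynomial.eval₂Hom_bind₁ (RingHom.id ℝ) _ g p).symm

theorem polyFun_contDiff {u : Pt d → ℝ} (hu : u ∈ polyFun d n) : ContDiff ℝ (⊤ : ℕ∞) u := by
  obtain ⟨p, -, hp⟩ := hu
  rw [funext hp]
  clear hp u
  induction p using MvPolynomial.induction_on with
  | C a => simpa using contDiff_const
  | add p q hp hq => simpa using hp.add hq
  | mul_X p i hp =>
    simp only [map_mul, MvPolynomial.eval_X]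
    exact hp.mul (EuclideanSpace.proj (𝕜 := ℝ) i).contDiff

theorem polyFun_continuous {u : Pt d → ℝ} (hu : u ∈ polyFun d n) : Continuous u :=
  (polyFun_contDiff hu).continuous

end polyFun

/-! ### Lagrange nodes and unisolvence -/

open Classical in
/-- The points with barycentric coordinates in `ℓ⁻¹ ℕ` with respect to the vertex set `S`. -/
def nodes {d : ℕ} (S : Finset (Pt d)) (ℓ : ℕ) : Finset (Pt d) :=
  (Finset.piAntidiag S ℓ).image fun k => ∑ v ∈ S, ((k v : ℝ) / (ℓ : ℝ)) • v

variable {d ℓ : ℕ}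

theorem mem_nodes {S : Finset (Pt d)} {x : Pt d} :
    x ∈ nodes S ℓ ↔ ∃ k : Pt d → ℕ, (∑ v ∈ S, k v = ℓ ∧ ∀ v, k v ≠ 0 → v ∈ S) ∧
      ∑ v ∈ S, ((k v : ℝ) / (ℓ : ℝ)) • v = x := by
  classical
  simp [nodes]

theorem mem_nodes_of_sum {S : Finset (Pt d)} (k : Pt d → ℕ) (hk : ∑ v ∈ S, k v = ℓ) :
    ∑ v ∈ S, ((k v : ℝ) / (ℓ : ℝ)) • v ∈ nodes S ℓ := by
  classical
  rw [mem_nodes]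
  refine ⟨fun v => if v ∈ S then k v else 0, ⟨?_, fun v hv => ?_⟩, ?_⟩
  · rw [← hk]
    exact Finset.sum_congr rfl fun v hv => if_pos hv
  · by_contra h
    simp [h] at hv
  · exact Finset.sum_congr rfl fun v hv => by simp only [if_pos hv]

theorem nodes_subset_hull (hℓ : ℓ ≠ 0) {S : Finset (Pt d)} {x : Pt d} (hx : x ∈ nodes S ℓ) :
    x ∈ hull S := by
  obtain ⟨k, ⟨hk, -⟩, rfl⟩ := mem_nodes.1 hx
  rw [hull, Finset.mem_convexHull']
  refine ⟨fun v => (k v : ℝ) / ℓ, fun v _ => by positivity, ?_, rfl⟩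
  rw [← Finset.sum_div, ← Nat.cast_sum, hk, div_self (by exact_mod_cast hℓ)]

theorem nodes_mono {S S' : Finset (Pt d)} (h : S ⊆ S') : nodes S ℓ ⊆ nodes S' ℓ := by
  intro x hx
  obtain ⟨k, ⟨hk, hkS⟩, rfl⟩ := mem_nodes.1 hx
  have h0 : ∀ v ∈ S', v ∉ S → k v = 0 := fun v _ hv => by
    by_contra h'
    exact hv (hkS v h')
  refine mem_nodes.2 ⟨k, ⟨?_, fun v hv => h (hkS v hv)⟩, ?_⟩
  · rw [← hk, Finset.sum_subset h h0]
  · refine (Finset.sum_subset h fun v hv hvS => ?_).symm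
    simp [h0 v hv hvS]

/-- A polynomial of degree at most `ℓ` that vanishes at the Lagrange nodes vanishes on the hull. -/
theorem polyFun_eq_zero_of_nodes (hℓ : ℓ ≠ 0) (S : Finset (Pt d)) {u : Pt d → ℝ}
    (hu : u ∈ polyFun d ℓ) (h0 : ∀ x ∈ nodes S ℓ, u x = 0) {x : Pt d} (hx : x ∈ hull S) :
    u x = 0 := by
  classical
  obtain ⟨p, hp, hpu⟩ := hu
  have hℓ' : (ℓ : ℝ) ≠ 0 := by exact_mod_cast hℓ
  rcases S.eq_empty_or_nonempty with rfl | ⟨v₀, hv₀⟩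
  · simp [hull] at hx
  -- The variables are the barycentric coordinates other than that of `v₀`, multiplied by ℓ: nodes
  -- become the points with natural coordinates of sum at most ℓ. Only this parametrisation of the
  -- hull enters, so `S` may be a face.
  let σ := {v // v ∈ S.erase v₀}
  let g : Fin d → MvPolynomial σ ℝ := fun i => MvPolynomial.C (v₀ i) +
    ∑ v : σ, MvPolynomial.C ((v.1 i - v₀ i) / ℓ) * MvPolynomial.X v
  have hg : ∀ i, (g i).totalDegree ≤ 1 := fun i => by
    refine (MvPolynomial.totalDegree_add _ _).trans (max_le (by simp) ?_)
    refine MvPolynomial.totalDegree_finsetSum_le fun v _ => ?_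
    refine (MvPolynomial.totalDegree_mul _ _).trans ?_
    simp
  set q := MvPolynomial.bind₁ g p with hq
  have hqdeg : q.totalDegree ≤ ℓ := (totalDegree_bind₁_le g hg p).trans hp
  have heval : ∀ a : Pt d → ℝ, ∑ v ∈ S, a v = 1 →
      u (∑ v ∈ S, a v • v) = MvPolynomial.eval (fun v : σ => ℓ * a v.1) q := by
    intro a ha
    rw [hpu, hq]
    have e : (fun i => (∑ v ∈ S, a v • v) i) =
        fun i => MvPolynomial.eval (fun v : σ => ℓ * a v.1) (g i) := by
      funext i
      simp only [g, map_add, MvPolynomial.eval_C, map_sum, map_mul, MvPolynomial.eval_X]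
      rw [Finset.sum_coe_sort (S.erase v₀) (fun v => (v i - v₀ i) / ℓ * (ℓ * a v))]
      rw [← Finset.add_sum_erase _ _ hv₀] at ha ⊢
      have : a v₀ = 1 - ∑ v ∈ S.erase v₀, a v := by linarith
      simp only [PiLp.add_apply, PiLp.smul_apply, WithLp.ofLp_sum, Finset.sum_apply,
        WithLp.ofLp_smul, Pi.smul_apply, smul_eq_mul, this]
      rw [sub_mul, one_mul, Finset.sum_mul, sub_add, sub_eq_add_neg, ← Finset.sum_sub_distrib,
        ← Finset.sum_neg_distrib]
      congr 1
      refine Finset.sum_congr rfl fun v _ => ?_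
      field_simp
      ring
    rw [e]
    exact (MvPolynomial.eval₂Hom_bind₁ (RingHom.id ℝ) _ g p).symm
  have hq0 : q = 0 := by
    by_contra hne
    -- For a monomial `t` of top degree, the combinatorial Nullstellensatz gives a point `m` of the
    -- grid ∏ {0, …, t v} where `q` is nonzero. Since Σ m ≤ deg q ≤ ℓ, assigning the remainder ℓ - Σ
    -- m to `v₀` makes it a node: a contradiction.
    obtain ⟨t, htm, ht⟩ : ∃ t ∈ q.support, t.degree = q.totalDegree := by
      obtain ⟨t, ht, h⟩ := Finset.exists_mem_eq_sup q.support
        (MvPolynomial.support_nonempty.2 hne) (fun t => t.degree)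
      exact ⟨t, ht, h.symm⟩
    obtain ⟨s, hs, hse⟩ := MvPolynomial.combinatorial_nullstellensatz_exists_eval_nonzero q t
      (MvPolynomial.mem_support_iff.1 htm) ht.symm
      (fun v => (Finset.range (t v + 1)).image (fun j : ℕ => (j : ℝ)))
      (fun v => by rw [Finset.card_image_of_injective _ Nat.cast_injective]; simp)
    simp only [Finset.mem_image, Finset.mem_range] at hs
    choose m hm hms using hs
    have hmle : ∑ v, m v ≤ ℓ := by
      refine le_trans ?_ (ht.trans_le hqdeg)
      rw [Finsupp.degree_eq_sum]
      exact Finset.sum_le_sum fun v _ => Nat.lt_succ_iff.1 (hm v)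
    let k : Pt d → ℕ := fun v => if h : v ∈ S.erase v₀ then m ⟨v, h⟩ else ℓ - ∑ v, m v
    have hk : ∑ v ∈ S, k v = ℓ := by
      rw [← Finset.add_sum_erase _ _ hv₀]
      have h1 : k v₀ = ℓ - ∑ v, m v := dif_neg (by simp)
      have h2 : ∑ v ∈ S.erase v₀, k v = ∑ v, m v := by
        rw [← Finset.sum_coe_sort]
        exact Finset.sum_congr rfl fun v _ => dif_pos v.2
      omega
    apply hse
    have h3 := h0 _ (mem_nodes_of_sum k hk)
    rw [heval] at h3
    · rw [← h3]
      congr 2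
      funext v
      rw [mul_div_cancel₀ _ hℓ', ← hms v]
      have : k v.1 = m v := dif_pos v.2
      rw [this]
    · rw [← Finset.sum_div, ← Nat.cast_sum, hk, div_self hℓ']
  rw [hull, Finset.mem_convexHull'] at hx
  obtain ⟨a, -, ha, rfl⟩ := hx
  rw [heval a ha, hq0, map_zero]

end

section

variable {d ℓ : ℕ}

/-! ### Simplices -/

/-- `S` is the vertex set of a (nondegenerate) `d`-simplex. -/
structure IsSimplex (S : Finset (Pt d)) : Prop where
  card_eq : S.card = d + 1
  affineIndependent : AffineIndependent ℝ ((↑) : S → Pt d)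

theorem hull_isCompact (S : Finset (Pt d)) : IsCompact (hull S) :=
  S.finite_toSet.isCompact_convexHull ℝ

theorem hull_measurableSet (S : Finset (Pt d)) : MeasurableSet (hull S) :=
  (hull_isCompact S).isClosed.measurableSet

theorem hull_mono {S S' : Finset (Pt d)} (h : S ⊆ S') : hull S ⊆ hull S' :=
  convexHull_mono (by exact_mod_cast h)

theorem affineMap_sum {ι V : Type*} [AddCommGroup V] [Module ℝ V] (A : Pt d →ᵃ[ℝ] V)
    (s : Finset ι) (a : ι → ℝ) (p : ι → Pt d) (ha : ∑ i ∈ s, a i = 1) :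
    A (∑ i ∈ s, a i • p i) = ∑ i ∈ s, a i • A (p i) := by
  have h : ∀ x, A x = A.linear x + A 0 := fun x => by simpa using A.map_vadd 0 x
  rw [h]
  simp_rw [fun i => h (p i), smul_add, Finset.sum_add_distrib, ← Finset.sum_smul, ha, one_smul,
    map_sum, map_smul]

namespace IsSimplex

variable {S : Finset (Pt d)}

theorem affineSpan_eq_top (hS : IsSimplex S) : affineSpan ℝ (range ((↑) : S → Pt d)) = ⊤ := by
  rw [hS.affineIndependent.affineSpan_eq_top_iff_card_eq_finrank_add_one]
  simp [hS.card_eq]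

/-- The vertices of a simplex as an affine basis. -/
def affineBasis (hS : IsSimplex S) : AffineBasis S ℝ (Pt d) :=
  ⟨(↑), hS.affineIndependent, hS.affineSpan_eq_top⟩

theorem exists_barycentric (hS : IsSimplex S) : ∃ b : Pt d → (Pt d →ᵃ[ℝ] ℝ),
    (∀ v ∈ S, b v v = 1) ∧ (∀ v ∈ S, ∀ w ∈ S, w ≠ v → b v w = 0) ∧
    (∀ x, ∑ v ∈ S, b v x = 1) ∧ ∀ x, ∑ v ∈ S, b v x • v = x := by
  classical
  let b : Pt d → (Pt d →ᵃ[ℝ] ℝ) := fun v =>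
    if h : v ∈ S then hS.affineBasis.coord ⟨v, h⟩ else 0
  have hb : ∀ v : S, b v = hS.affineBasis.coord v := fun v => dif_pos v.2
  refine ⟨b, fun v hv => ?_, fun v hv w hw hne => ?_, fun x => ?_, fun x => ?_⟩
  · rw [hb ⟨v, hv⟩]
    exact hS.affineBasis.coord_apply_eq ⟨v, hv⟩
  · rw [hb ⟨v, hv⟩]
    exact hS.affineBasis.coord_apply_ne (i := ⟨v, hv⟩) (j := ⟨w, hw⟩)
      (fun h => hne (Subtype.ext_iff.1 h).symm)
  · rw [← Finset.sum_coe_sort]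
    simp_rw [hb]
    exact hS.affineBasis.sum_coord_apply_eq_one x
  · rw [← Finset.sum_coe_sort S (fun v => b v x • v)]
    simp_rw [hb]
    exact hS.affineBasis.linear_combination_coord_eq_self x

theorem interior_nonempty (hS : IsSimplex S) : (interior (hull S)).Nonempty := by
  rw [hull, interior_convexHull_nonempty_iff_affineSpan_eq_top]
  simpa using hS.affineSpan_eq_top

theorem closure_interior (hS : IsSimplex S) : closure (interior (hull S)) = hull S := by
  rw [hull, (convex_convexHull ℝ _).closure_interior_eq_closure_of_nonempty_interior
    hS.interior_nonempty]
  exact (hull_isCompact S).isClosed.closure_eq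

theorem volume_pos (hS : IsSimplex S) : 0 < volume.real (hull S) :=
  ENNReal.toReal_pos
    (Measure.measure_pos_of_nonempty_interior volume hS.interior_nonempty).ne'
    (hull_isCompact S).measure_lt_top.ne

/-- The function is ∏_v ∏_{j < k v} (ℓ b_v - j) / (k v - j), of degree Σ k v = ℓ. A different node
k' has the same sum ℓ, so k' v < k v for some v, and the factor with j = k' v vanishes there. -/
theorem exists_lagrange (hS : IsSimplex S) (hℓ : ℓ ≠ 0) {ν : Pt d} (hν : ν ∈ nodes S ℓ) :
    ∃ u ∈ polyFun d ℓ, u ν = 1 ∧ ∀ ν' ∈ nodes S ℓ, ν' ≠ ν → u ν' = 0 := by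
  classical
  have hℓ' : (ℓ : ℝ) ≠ 0 := by exact_mod_cast hℓ
  obtain ⟨b, hb1, hb0, -, -⟩ := hS.exists_barycentric
  have hbn : ∀ k : Pt d → ℕ, ∑ v ∈ S, k v = ℓ → ∀ v ∈ S,
      ℓ * b v (∑ w ∈ S, ((k w : ℝ) / ℓ) • w) = k v := by
    intro k hk v hv
    rw [affineMap_sum (b v) S _ _ (by
      rw [← Finset.sum_div, ← Nat.cast_sum, hk, div_self hℓ']),
      Finset.sum_eq_single v (fun w hw hne => by rw [hb0 v hv w hw hne, smul_zero])
        (fun h => absurd hv h), hb1 v hv, smul_eq_mul, mul_one, mul_div_cancel₀ _ hℓ']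
  obtain ⟨k, ⟨hk, -⟩, rfl⟩ := mem_nodes.1 hν
  let u : Pt d → ℝ := ∏ v ∈ S, ∏ j ∈ Finset.range (k v),
    fun x => (ℓ * b v x - j) * ((k v : ℝ) - j)⁻¹
  have hu : ∀ x, u x = ∏ v ∈ S, ∏ j ∈ Finset.range (k v),
    ((ℓ * b v x - j) * ((k v : ℝ) - j)⁻¹) := fun x => by simp [u]
  refine ⟨u, ?_, ?_, ?_⟩
  · have h := polyFun_prod (d := d) S (fun v => ∏ j ∈ Finset.range (k v),
      fun x => (ℓ * b v x - j) * ((k v : ℝ) - j)⁻¹) k (fun v _ => ?_)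
    · rwa [hk] at h
    · have h := polyFun_prod (d := d) (Finset.range (k v))
        (fun j x => (ℓ * b v x - j) * ((k v : ℝ) - j)⁻¹) (fun _ => 1) (fun j _ => ?_)
      · simpa using h
      · have h1 := (polyFun d 1).smul_mem ((k v : ℝ) - j)⁻¹
          ((polyFun d 1).sub_mem ((polyFun d 1).smul_mem (ℓ : ℝ) (polyFun_affine (b v)))
            (polyFun_const (j : ℝ)))
        convert h1 using 1
        funext x
        simp [mul_comm]
  · rw [hu]
    refine Finset.prod_eq_one fun v hv => Finset.prod_eq_one fun j hj => ?_
    rw [hbn k hk v hv]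
    refine mul_inv_cancel₀ (sub_ne_zero.2 ?_)
    exact_mod_cast (Finset.mem_range.1 hj).ne'
  · intro ν' hν' hne
    obtain ⟨k', ⟨hk', -⟩, rfl⟩ := mem_nodes.1 hν'
    obtain ⟨v, hv, hlt⟩ : ∃ v ∈ S, k' v < k v := by
      by_contra! hle
      refine hne (Finset.sum_congr rfl fun v hv => ?_)
      rw [(Finset.sum_eq_sum_iff_of_le hle).1 (hk.trans hk'.symm) v hv]
    rw [hu]
    refine Finset.prod_eq_zero hv (Finset.prod_eq_zero (Finset.mem_range.2 hlt) ?_)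
    rw [hbn k' hk' v hv, sub_self, zero_mul]

/-- Lagrange interpolation on a simplex. -/
theorem exists_interp (hS : IsSimplex S) (hℓ : ℓ ≠ 0) (c : Pt d → ℝ) :
    ∃ u ∈ polyFun d ℓ, ∀ ν ∈ nodes S ℓ, u ν = c ν := by
  classical
  choose! L hL hL1 hL0 using fun ν (hν : ν ∈ nodes S ℓ) => hS.exists_lagrange hℓ hν
  refine ⟨∑ ν ∈ nodes S ℓ, c ν • L ν,
    Submodule.sum_mem _ fun ν hν => Submodule.smul_mem _ _ (hL ν hν), fun ν hν => ?_⟩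
  rw [Finset.sum_apply, Finset.sum_eq_single ν (fun w hw hne => ?_) (fun h => absurd hν h)]
  · simp [hL1 ν hν]
  · simp [hL0 w hw ν hν hne.symm]

/-- Any two simplices are affinely equivalent. -/
theorem exists_affine_image (hS : IsSimplex S) {S' : Finset (Pt d)} (hS' : IsSimplex S') :
    ∃ (L : Pt d ≃ₗ[ℝ] Pt d) (c : Pt d), (fun x => L x + c) '' (S : Set (Pt d)) = S' := by
  classical
  have e : S ≃ S' := S.equivOfCardEq (hS.card_eq.trans hS'.card_eq.symm)
  let b := hS.affineBasis.reindex e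
  let b' := hS'.affineBasis
  obtain ⟨i⟩ : Nonempty S' := b'.nonempty
  -- The linear part matches the edge vectors issuing from one chosen vertex; the translation is
  -- then fixed by that vertex.
  let L : Pt d ≃ₗ[ℝ] Pt d := (b.basisOf i).equiv (b'.basisOf i) (Equiv.refl _)
  have hL : ∀ j : S', L (b j) + (b' i - L (b i)) = b' j := by
    intro j
    by_cases hj : j = i
    · subst hj
      abel
    · have h1 : L (b.basisOf i ⟨j, hj⟩) = b'.basisOf i ⟨j, hj⟩ :=
        Module.Basis.equiv_apply ..
      rw [AffineBasis.basisOf_apply, AffineBasis.basisOf_apply, vsub_eq_sub, vsub_eq_sub,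
        map_sub] at h1
      rw [add_sub, add_sub_right_comm, h1]
      abel
  have hb : ∀ j : S', b j = (e.symm j : Pt d) := fun j => by
    rw [AffineBasis.reindex_apply]
    rfl
  refine ⟨L, b' i - L (b i), Subset.antisymm ?_ ?_⟩
  · rintro _ ⟨v, hv, rfl⟩
    have h1 := hL (e ⟨v, hv⟩)
    rw [hb (e ⟨v, hv⟩), Equiv.symm_apply_apply] at h1
    refine (congrArg (· ∈ (S' : Set (Pt d))) h1).mpr ?_
    exact (e ⟨v, hv⟩).2
  · intro v hv
    refine ⟨e.symm ⟨v, hv⟩, (e.symm ⟨v, hv⟩).2, ?_⟩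
    have h1 := hL ⟨v, hv⟩
    rw [hb ⟨v, hv⟩] at h1
    exact h1

end IsSimplex

/-! ### Equivalence of the `L₂`-norm and the nodal norm on a simplex -/

theorem norm_toLp_sq {α : Type*} {m : MeasurableSpace α} {μ : Measure α} {f : α → ℝ}
    (h : MemLp f 2 μ) : ‖h.toLp f‖ ^ 2 = ∫ x, f x ^ 2 ∂μ := by
  rw [← real_inner_self_eq_norm_sq, L2.inner_def]
  refine integral_congr_ae ?_
  filter_upwards [h.coeFn_toLp] with x hx
  simp only [hx, real_inner_self_eq_norm_sq, Real.norm_eq_abs, sq_abs]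

theorem memLp_hull {u : Pt d → ℝ} (hu : Continuous u) (S : Finset (Pt d)) :
    MemLp u 2 (volume.restrict (hull S)) := by
  have : IsFiniteMeasure (volume.restrict (hull S)) :=
    ⟨by simpa using (hull_isCompact S).measure_lt_top⟩
  obtain ⟨A, hA⟩ := (hull_isCompact S).exists_bound_of_continuousOn hu.continuousOn
  refine MemLp.of_bound (C := A) hu.aestronglyMeasurable ?_
  filter_upwards [ae_restrict_mem (hull_measurableSet S)] with x hx using hA x hx

/-- The map from nodal values to the L₂ class of their interpolant is linear on a finite dimensional
space, hence bounded. It is injective, since an interpolant vanishing almost everywhere vanishes on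
the interior and, by density, at the nodes; hence it is also bounded below. -/
theorem IsSimplex.norm_equiv {S : Finset (Pt d)} (hS : IsSimplex S) (hℓ : ℓ ≠ 0) :
    ∃ C : ℝ, 0 < C ∧ ∀ u ∈ polyFun d ℓ,
      ∑ ν ∈ nodes S ℓ, u ν ^ 2 ≤ C * ∫ x in hull S, u x ^ 2 ∧
      ∫ x in hull S, u x ^ 2 ≤ C * ∑ ν ∈ nodes S ℓ, u ν ^ 2 := by
  classical
  choose! B hB hB1 hB0 using fun ν (hν : ν ∈ nodes S ℓ) => hS.exists_lagrange hℓ hν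
  let I : EuclideanSpace ℝ (nodes S ℓ) →ₗ[ℝ] (Pt d → ℝ) :=
    { toFun := fun c => ∑ ν, c ν • B ν
      map_add' := fun c c' => by simp [add_smul, Finset.sum_add_distrib]
      map_smul' := fun a c => by simp [Finset.smul_sum, mul_smul] }
  have hIp : ∀ c, I c ∈ polyFun d ℓ := fun c =>
    Submodule.sum_mem _ fun ν _ => Submodule.smul_mem _ _ (hB ν ν.2)
  have hIc : ∀ c, Continuous (I c) := fun c => polyFun_continuous (hIp c)
  have hIn : ∀ c, ∀ ν : nodes S ℓ, I c ν = c ν := by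
    intro c ν
    change (∑ ν, c ν • B ν) (ν : Pt d) = _
    rw [Finset.sum_apply, Finset.sum_eq_single ν (fun w _ hne => ?_) (by simp)]
    · simp [hB1 ν ν.2]
    · simp [hB0 w w.2 ν ν.2 (fun h => hne (Subtype.ext h.symm))]
  let J : EuclideanSpace ℝ (nodes S ℓ) →ₗ[ℝ] Lp ℝ 2 (volume.restrict (hull S)) :=
    { toFun := fun c => (memLp_hull (hIc c) S).toLp _
      map_add' := fun c c' => by
        rw [← MemLp.toLp_add]
        exact MemLp.toLp_congr _ _ (by rw [map_add])
      map_smul' := fun a c => by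
        rw [← MemLp.toLp_const_smul]
        exact MemLp.toLp_congr _ _ (by rw [map_smul]; rfl) }
  have hJn : ∀ c, ‖J c‖ ^ 2 = ∫ x in hull S, I c x ^ 2 := fun c =>
    norm_toLp_sq (memLp_hull (hIc c) S)
  have hJ : J.ker = ⊥ := by
    refine LinearMap.ker_eq_bot'.2 fun c hc => ?_
    have h1 : I c =ᵐ[volume.restrict (hull S)] fun _ => 0 := by
      have h2 := (memLp_hull (hIc c) S).coeFn_toLp
      have h3 : (memLp_hull (hIc c) S).toLp _ = 0 := hc
      rw [h3] at h2
      exact h2.symm.trans (Lp.coeFn_zero _ _ _)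
    have h4 : EqOn (I c) (fun _ => 0) (interior (hull S)) :=
      Measure.eqOn_open_of_ae_eq (ae_restrict_of_ae_restrict_of_subset interior_subset h1)
        isOpen_interior (hIc c).continuousOn continuousOn_const
    have h5 : EqOn (I c) (fun _ => 0) (hull S) := by
      rw [← hS.closure_interior]
      exact h4.closure (hIc c) continuous_const
    ext ν
    rw [← hIn]
    exact h5 (nodes_subset_hull hℓ ν.2)
  obtain ⟨K, hK0, hK⟩ := J.exists_antilipschitzWith hJ
  let J' := LinearMap.toContinuousLinearMap J
  refine ⟨(K : ℝ) ^ 2 + ‖J'‖ ^ 2, by positivity, fun u hu => ?_⟩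
  let c : EuclideanSpace ℝ (nodes S ℓ) := WithLp.toLp 2 fun ν => u ν
  have hc : ∑ ν ∈ nodes S ℓ, u ν ^ 2 = ‖c‖ ^ 2 := by
    rw [EuclideanSpace.real_norm_sq_eq, ← Finset.sum_coe_sort]
  have huI : ∀ x ∈ hull S, u x = I c x := by
    intro x hx
    refine sub_eq_zero.1 (polyFun_eq_zero_of_nodes hℓ S
      ((polyFun d ℓ).sub_mem hu (hIp c)) (fun ν hν => ?_) hx)
    exact sub_eq_zero.2 (hIn c ⟨ν, hν⟩).symm
  have hint : ∫ x in hull S, u x ^ 2 = ‖J c‖ ^ 2 := by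
    rw [hJn]
    exact setIntegral_congr_fun (hull_measurableSet S) fun x hx => by simp only [huI x hx]
  rw [hc, hint]
  have h1 : ‖c‖ ≤ K * ‖J c‖ := by simpa using! hK.le_mul_norm_sub 0 c
  have h2 : ‖J c‖ ≤ ‖J'‖ * ‖c‖ := J'.le_opNorm c
  constructor
  · calc ‖c‖ ^ 2 ≤ (K * ‖J c‖) ^ 2 := by gcongr
      _ = (K : ℝ) ^ 2 * ‖J c‖ ^ 2 := by ring
      _ ≤ _ := by gcongr; exact le_add_of_nonneg_right (by positivity)
  · calc ‖J c‖ ^ 2 ≤ (‖J'‖ * ‖c‖) ^ 2 := by gcongr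
      _ = ‖J'‖ ^ 2 * ‖c‖ ^ 2 := by ring
      _ ≤ _ := by gcongr; exact le_add_of_nonneg_left (by positivity)

theorem setIntegral_affine_image (L : Pt d ≃ₗ[ℝ] Pt d) (c : Pt d) {s : Set (Pt d)}
    (hs : MeasurableSet s) (f : Pt d → ℝ) :
    ∫ x in (fun x => L x + c) '' s, f x =
      |LinearMap.det (L : Pt d →ₗ[ℝ] Pt d)| * ∫ x in s, f (L x + c) := by
  let L' : Pt d →L[ℝ] Pt d := LinearMap.toContinuousLinearMap (L : Pt d →ₗ[ℝ] Pt d)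
  have h := integral_image_eq_integral_abs_det_fderiv_smul volume hs
    (f := fun x => L x + c) (f' := fun _ => L')
    (fun x _ => (L'.hasFDerivAt.add_const c).hasFDerivWithinAt)
    (fun x _ y _ hxy => L.injective (add_right_cancel hxy)) f
  rw [h, ← integral_const_mul]
  rfl

theorem hull_affine_image (L : Pt d ≃ₗ[ℝ] Pt d) (c : Pt d) {S S' : Finset (Pt d)}
    (h : (fun x => L x + c) '' (S : Set (Pt d)) = S') :
    (fun x => L x + c) '' hull S = hull S' := by
  let A : Pt d →ᵃ[ℝ] Pt d := (L : Pt d →ₗ[ℝ] Pt d).toAffineMap + AffineMap.const ℝ (Pt d) c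
  have := A.image_convexHull (S : Set (Pt d))
  rw [hull, hull, ← h]
  exact this

theorem nodes_affine_image (hℓ : ℓ ≠ 0) (L : Pt d ≃ₗ[ℝ] Pt d) (c : Pt d) {S S' : Finset (Pt d)}
    (h : (fun x => L x + c) '' (S : Set (Pt d)) = S') (f : Pt d → ℝ) :
    ∑ ν ∈ nodes S' ℓ, f ν = ∑ ν ∈ nodes S ℓ, f (L ν + c) := by
  classical
  have hinj : Function.Injective (fun x => L x + c) :=
    fun x y hxy => L.injective (add_right_cancel hxy)
  have hS' : S' = S.image (fun x => L x + c) := by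
    rw [← Finset.coe_inj, Finset.coe_image, h]
  have hℓ' : (ℓ : ℝ) ≠ 0 := by exact_mod_cast hℓ
  have hpt : ∀ k : Pt d → ℝ, ∑ v ∈ S, k v = 1 →
      L (∑ v ∈ S, k v • v) + c = ∑ v ∈ S, k v • (L v + c) := by
    intro k hk
    simp_rw [smul_add, Finset.sum_add_distrib, ← Finset.sum_smul, hk, one_smul, map_sum, map_smul]
  have hsum : ∀ k : Pt d → ℕ, ∑ v ∈ S, k v = ℓ → ∑ v ∈ S, (k v : ℝ) / ℓ = 1 := fun k hk => by
    rw [← Finset.sum_div, ← Nat.cast_sum, hk, div_self hℓ']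
  have hn : nodes S' ℓ = (nodes S ℓ).image (fun x => L x + c) := by
    ext x
    rw [Finset.mem_image]
    constructor
    · intro hx
      obtain ⟨k, ⟨hk, -⟩, rfl⟩ := mem_nodes.1 hx
      rw [hS', Finset.sum_image hinj.injOn] at hk
      refine ⟨_, mem_nodes_of_sum (fun v => k (L v + c)) hk, ?_⟩
      rw [hpt _ (hsum _ hk), hS', Finset.sum_image hinj.injOn]
    · rintro ⟨y, hy, rfl⟩
      obtain ⟨k, ⟨hk, -⟩, rfl⟩ := mem_nodes.1 hy
      have hki : ∀ v, k (L.symm (L v + c - c)) = k v := fun v => by simp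
      have := mem_nodes_of_sum (ℓ := ℓ) (S := S') (fun w => k (L.symm (w - c))) (by
        rw [hS', Finset.sum_image hinj.injOn]
        simpa using hk)
      rw [hS', Finset.sum_image hinj.injOn] at this
      rw [hpt _ (hsum _ hk), hS']
      simpa using this
  rw [hn, Finset.sum_image hinj.injOn]

/-- On a `d`-simplex, the `L₂`-norm of a polynomial of degree at most `ℓ` is equivalent to the
scaled Euclidean norm of its nodal values, uniformly over all simplices. -/
theorem exists_uniform_norm_equiv (d : ℕ) {ℓ : ℕ} (hℓ : ℓ ≠ 0) :
    ∃ C : ℝ, 0 < C ∧ ∀ S : Finset (Pt d), IsSimplex S → ∀ u ∈ polyFun d ℓ,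
      volume.real (hull S) * ∑ ν ∈ nodes S ℓ, u ν ^ 2 ≤ C * ∫ x in hull S, u x ^ 2 ∧
      ∫ x in hull S, u x ^ 2 ≤ C * (volume.real (hull S) * ∑ ν ∈ nodes S ℓ, u ν ^ 2) := by
  -- Any simplex can serve as reference; without one there is nothing to prove.
  by_cases hex : ∃ S : Finset (Pt d), IsSimplex S
  swap
  · exact ⟨1, one_pos, fun S hS => absurd ⟨S, hS⟩ hex⟩
  obtain ⟨S₀, hS₀⟩ := hex
  obtain ⟨C, hC, hCu⟩ := hS₀.norm_equiv hℓ
  have hV := hS₀.volume_pos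
  set V := volume.real (hull S₀) with hVdef
  -- The determinant multiplies the volume and the integral alike and cancels. The reference volume
  -- `V` leaves the factor `V * C` in one bound and `C / V` in the other; the sum covers both.
  refine ⟨V * C + C / V, by positivity, fun S hS u hu => ?_⟩
  obtain ⟨L, c, hLc⟩ := hS₀.exists_affine_image hS
  have hu' : (fun x => u (L x + c)) ∈ polyFun d ℓ :=
    polyFun_comp_affine hu
      ((L : Pt d →ₗ[ℝ] Pt d).toAffineMap + AffineMap.const ℝ (Pt d) c)
  obtain ⟨h1, h2⟩ := hCu _ hu'
  rw [nodes_affine_image hℓ L c hLc, ← hull_affine_image L c hLc,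
    setIntegral_affine_image L c (hull_measurableSet S₀)]
  have hvol : volume.real ((fun x => L x + c) '' hull S₀) =
      |LinearMap.det (L : Pt d →ₗ[ℝ] Pt d)| * V := by
    have := setIntegral_affine_image L c (hull_measurableSet S₀) (fun _ => 1)
    simpa using this
  rw [hvol]
  set D := |LinearMap.det (L : Pt d →ₗ[ℝ] Pt d)|
  set a := ∑ ν ∈ nodes S₀ ℓ, u (L ν + c) ^ 2
  set i := ∫ x in hull S₀, u (L x + c) ^ 2
  have hD : 0 ≤ D := abs_nonneg _
  have ha : 0 ≤ a := Finset.sum_nonneg fun _ _ => sq_nonneg _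
  have hi : 0 ≤ i := integral_nonneg fun _ => sq_nonneg _
  constructor
  · calc D * V * a ≤ D * V * (C * i) := by gcongr
      _ = V * C * (D * i) := by ring
      _ ≤ _ := by gcongr; exact le_add_of_nonneg_right (by positivity)
  · calc D * i ≤ D * (C * a) := by gcongr
      _ = C / V * (D * V * a) := by field_simp
      _ ≤ _ := by gcongr; exact le_add_of_nonneg_left (by positivity)

end

/-! ### Dominated convergence in L₂ and membership in H¹ -/

section

open Filter Topology in
theorem Lp_tendsto_of_bounded {α E : Type*} {m : MeasurableSpace α} {μ : Measure α}
    [IsFiniteMeasure μ] [NormedAddCommGroup E] {F : ℕ → Lp E 2 μ} {f : α → E} {A : ℝ}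
    (hA : ∀ n, ∀ᵐ x ∂μ, ‖F n x‖ ≤ A)
    (hlim : ∀ᵐ x ∂μ, Tendsto (fun n => F n x) atTop (𝓝 (f x))) :
    ∃ G : Lp E 2 μ, G =ᵐ[μ] f ∧ Tendsto F atTop (𝓝 G) := by
  have hf : AEStronglyMeasurable f μ :=
    aestronglyMeasurable_of_tendsto_ae atTop (fun n => (Lp.aestronglyMeasurable (F n))) hlim
  have hfA : ∀ᵐ x ∂μ, ‖f x‖ ≤ A := by
    filter_upwards [hlim, ae_all_iff.2 hA] with x hx hxA
    exact le_of_tendsto hx.norm (Eventually.of_forall hxA)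
  have hmem : MemLp f 2 μ := MemLp.of_bound hf A hfA
  refine ⟨hmem.toLp f, hmem.coeFn_toLp, ?_⟩
  rw [Lp.tendsto_Lp_iff_tendsto_eLpNorm']
  have h0 : Tendsto (fun n => ∫⁻ x, ‖F n x - hmem.toLp f x‖ₑ ^ (2 : ℝ) ∂μ) atTop
      (𝓝 (∫⁻ _, 0 ∂μ)) := by
    refine tendsto_lintegral_of_dominated_convergence'
      (fun _ => (ENNReal.ofReal (A + A)) ^ (2 : ℝ)) (fun n => ?_) (fun n => ?_) ?_ ?_
    · exact ((Lp.aestronglyMeasurable _).sub (Lp.aestronglyMeasurable _)).enorm.pow_const _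
    · filter_upwards [hA n, hfA, hmem.coeFn_toLp] with x h1 h2 h3
      gcongr
      rw [h3, ← ofReal_norm]
      exact ENNReal.ofReal_le_ofReal ((norm_sub_le _ _).trans (add_le_add h1 h2))
    · rw [lintegral_const]
      exact ENNReal.mul_ne_top (ENNReal.rpow_ne_top_of_nonneg (by norm_num) ENNReal.ofReal_ne_top)
        (measure_ne_top _ _)
    · filter_upwards [hlim, hmem.coeFn_toLp] with x h1 h3
      rw [h3]
      have h4 : Tendsto (fun n => ‖F n x - f x‖ₑ) atTop (𝓝 0) := by
        have := (h1.sub_const (f x)).enorm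
        simpa using this
      have := h4.ennrpow_const 2
      rwa [ENNReal.zero_rpow_of_pos (by norm_num)] at this
  have h1 := h0.ennrpow_const (1 / 2)
  rw [lintegral_zero, ENNReal.zero_rpow_of_pos (by norm_num)] at h1
  refine h1.congr fun n => ?_
  rw [eLpNorm_eq_lintegral_rpow_enorm_toReal (by norm_num) (by norm_num)]
  simp

section H1

variable {d : ℕ} {Ω : PolytopalDomain d} {γ : Set (Pt d)}

instance isFiniteMeasure_restrict_carrier (Ω : PolytopalDomain d) :
    IsFiniteMeasure (volume.restrict Ω.carrier) :=
  ⟨by simpa using Ω.isBounded.measure_lt_top⟩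

/-- The pair `(u, g)` is a limit in `L₂(Ω) × L₂(Ω)^d` of pairs `(v, ∇v)` with `v` smooth and
vanishing on `γ`. -/
def InH1 (Ω : PolytopalDomain d) (γ : Set (Pt d)) (u : Pt d → ℝ)
    (g : Pt d → StrongDual ℝ (Pt d)) : Prop :=
  ∃ p ∈ (smoothGraph Ω γ).topologicalClosure,
    p.1 =ᵐ[volume.restrict Ω.carrier] u ∧ p.2 =ᵐ[volume.restrict Ω.carrier] g

theorem InH1.exists_mem_H10 {u : Pt d → ℝ} {g : Pt d → StrongDual ℝ (Pt d)}
    (h : InH1 Ω γ u g) : ∃ f ∈ H10 Ω γ, f =ᵐ[volume.restrict Ω.carrier] u := by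
  obtain ⟨p, hp, hp1, -⟩ := h
  exact ⟨p.1, ⟨p, hp, rfl⟩, hp1⟩

-- Dominated convergence turns bounded pointwise convergence of functions and of gradients into
-- convergence in the graph space, where the closure is closed. All approximations below pass to the
-- limit in this way.
open Filter Topology in
theorem InH1.of_tendsto {u : ℕ → Pt d → ℝ} {g : ℕ → Pt d → StrongDual ℝ (Pt d)}
    {u' : Pt d → ℝ} {g' : Pt d → StrongDual ℝ (Pt d)} {A B : ℝ}
    (h : ∀ n, InH1 Ω γ (u n) (g n))
    (hA : ∀ n, ∀ x ∈ Ω.carrier, ‖u n x‖ ≤ A) (hB : ∀ n, ∀ x ∈ Ω.carrier, ‖g n x‖ ≤ B)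
    (hu : ∀ x ∈ Ω.carrier, Tendsto (fun n => u n x) atTop (𝓝 (u' x)))
    (hg : ∀ᵐ x ∂(volume.restrict Ω.carrier), Tendsto (fun n => g n x) atTop (𝓝 (g' x))) :
    InH1 Ω γ u' g' := by
  choose p hp hp1 hp2 using h
  have hmem := ae_restrict_mem (μ := volume) Ω.isOpen.measurableSet
  obtain ⟨U, hU, hUt⟩ := Lp_tendsto_of_bounded (F := fun n => (p n).1) (f := u') (A := A)
    (fun n => by
      filter_upwards [hp1 n, hmem] with x h1 hx
      rw [h1]
      exact hA n x hx)
    (by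
      filter_upwards [ae_all_iff.2 hp1, hmem] with x h1 hx
      simp_rw [h1]
      exact hu x hx)
  obtain ⟨G, hG, hGt⟩ := Lp_tendsto_of_bounded (F := fun n => (p n).2) (f := g') (A := B)
    (fun n => by
      filter_upwards [hp2 n, hmem] with x h1 hx
      rw [h1]
      exact hB n x hx)
    (by
      filter_upwards [ae_all_iff.2 hp2, hg] with x h1 hx
      simp_rw [h1]
      exact hx)
  refine ⟨(U, G), ?_, hU, hG⟩
  exact (Submodule.isClosed_topologicalClosure _).mem_of_tendsto (hUt.prodMk_nhds hGt)
    (Eventually.of_forall hp)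

theorem exists_bound_of_continuous (Ω : PolytopalDomain d) {u : Pt d → ℝ} (hu : Continuous u) :
    ∃ A, ∀ x ∈ Ω.carrier, ‖u x‖ ≤ A := by
  obtain ⟨A, hA⟩ := Ω.isBounded.isCompact_closure.exists_bound_of_continuousOn hu.continuousOn
  exact ⟨A, fun x hx => hA x (subset_closure hx)⟩

theorem InH1.of_contDiff {v : Pt d → ℝ} (hv : ContDiff ℝ (⊤ : ℕ∞) v) (h0 : ∀ x ∈ γ, v x = 0) :
    InH1 Ω γ v (fderiv ℝ v) := by
  have hc : Continuous (fderiv ℝ v) := hv.continuous_fderiv (by simp)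
  have h1 : MemLp v 2 (volume.restrict Ω.carrier) := by
    obtain ⟨A, hA⟩ := exists_bound_of_continuous Ω hv.continuous
    refine MemLp.of_bound (C := A) hv.continuous.aestronglyMeasurable ?_
    filter_upwards [ae_restrict_mem Ω.isOpen.measurableSet] with x hx using hA x hx
  have h2 : MemLp (fderiv ℝ v) 2 (volume.restrict Ω.carrier) := by
    obtain ⟨A, hA⟩ := exists_bound_of_continuous Ω hc.norm
    refine MemLp.of_bound (C := A) hc.aestronglyMeasurable ?_
    filter_upwards [ae_restrict_mem Ω.isOpen.measurableSet] with x hx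
    simpa using hA x hx
  exact ⟨(h1.toLp v, h2.toLp _), Submodule.le_topologicalClosure _
    ⟨v, hv, h0, h1.coeFn_toLp, h2.coeFn_toLp⟩, h1.coeFn_toLp, h2.coeFn_toLp⟩

/-! ### Mollification of Lipschitz functions -/

open Convolution in
/-- The mollification of `u` by a normalized bump function. -/
def mollify (φ : ContDiffBump (0 : Pt d)) (u : Pt d → ℝ) : Pt d → ℝ :=
  φ.normed volume ⋆[ContinuousLinearMap.lsmul ℝ ℝ, volume] u

-- The derivative is placed on `u`, which is only Lipschitz: by Rademacher's theorem `u` is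
-- differentiable almost everywhere, and its difference quotients are bounded by `K`, so
-- differentiation under the integral is justified.
open Convolution in
theorem hasFDerivAt_mollify (φ : ContDiffBump (0 : Pt d)) {u : Pt d → ℝ} {K : NNReal}
    (hu : LipschitzWith K u) (x : Pt d) :
    HasFDerivAt (mollify φ u)
      ((φ.normed volume ⋆[ContinuousLinearMap.lsmul ℝ ℝ, volume] fderiv ℝ u) x) x := by
  have hφc : Continuous (φ.normed (volume : Measure (Pt d))) := φ.continuous_normed
  have hφi : Integrable (φ.normed (volume : Measure (Pt d))) :=
    φ.integrable_normed
  have hdm : AEStronglyMeasurable (fun y => fderiv ℝ u (x - y)) volume :=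
    ((measurable_fderiv ℝ u).comp (measurable_const.sub measurable_id)).aestronglyMeasurable
  have h := hasFDerivAt_integral_of_dominated_loc_of_lip (𝕜 := ℝ) (μ := (volume : Measure (Pt d)))
    (F := fun x y => φ.normed volume y • u (x - y)) (x₀ := x) (s := univ)
    (F' := fun y => φ.normed volume y • fderiv ℝ u (x - y))
    (bound := fun y => φ.normed volume y * K) Filter.univ_mem
    (Filter.Eventually.of_forall fun z => (hφc.smul
      (hu.continuous.comp (continuous_const.sub continuous_id))).aestronglyMeasurable)
    ((hφc.smul (hu.continuous.comp (continuous_const.sub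
      continuous_id))).integrable_of_hasCompactSupport φ.hasCompactSupport_normed.smul_right)
    (hφc.aestronglyMeasurable.smul hdm)
    (Filter.Eventually.of_forall fun y => by
      refine LipschitzOnWith.of_dist_le_mul fun a _ b _ => ?_
      have h1 := hu.dist_le_mul (a - y) (b - y)
      rw [dist_sub_right] at h1
      rw [Real.dist_eq, ← smul_sub, smul_eq_mul, abs_mul, ← Real.dist_eq, Real.coe_nnabs, abs_mul,
        NNReal.abs_eq, mul_assoc]
      gcongr)
    (hφi.mul_const _)
    (by
      have h2 := (quasiMeasurePreserving_sub_left (volume : Measure (Pt d)) x).ae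
        (hu.ae_differentiableAt)
      filter_upwards [h2] with y hy
      have h3 : HasFDerivAt (fun z => u (z - y)) (fderiv ℝ u (x - y)) x := by
        have h4 := hy.hasFDerivAt.comp x ((hasFDerivAt_id x).sub_const y)
        rwa [ContinuousLinearMap.comp_id] at h4
      exact h3.fun_const_smul _)
  exact h.2

-- Mollification at a radius at most δ still vanishes on γ. Its gradients are the mollified
-- gradients of `u`: they are bounded by `K` and converge almost everywhere by Lebesgue
-- differentiation.
open Filter Topology in
theorem InH1.of_lipschitz_of_eventually {u : Pt d → ℝ} {K : NNReal} (hu : LipschitzWith K u)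
    {δ : ℝ} (hδ : 0 < δ) (h0 : ∀ x ∈ γ, ∀ y, dist y x < δ → u y = 0) :
    InH1 Ω γ u (fderiv ℝ u) := by
  obtain ⟨A, hA⟩ := exists_bound_of_continuous Ω hu.continuous
  -- The outer radius `2 * r n` is at most δ, to preserve the zeros on γ, and at most 1, to give the
  -- uniform bound `A + K`.
  let r : ℕ → ℝ := fun n => (min δ 1 / 2) * (1 / ((n : ℝ) + 1))
  have hm : 0 < min δ 1 := lt_min hδ one_pos
  have hr0 : ∀ n, 0 < r n := fun n => by positivity
  have hr1 : ∀ n, 2 * r n ≤ min δ 1 := fun n => by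
    have : 1 / ((n : ℝ) + 1) ≤ 1 := by
      rw [div_le_one (by positivity)]
      linarith [n.cast_nonneg (α := ℝ)]
    have := mul_le_mul_of_nonneg_left this (by positivity : 0 ≤ min δ 1 / 2)
    simp only [r]
    linarith
  let φ : ℕ → ContDiffBump (0 : Pt d) := fun n => ⟨r n, 2 * r n, hr0 n, by linarith [hr0 n]⟩
  have hφ : Tendsto (fun n => (φ n).rOut) atTop (𝓝 0) := by
    have := (tendsto_one_div_add_atTop_nhds_zero_nat (𝕜 := ℝ)).const_mul (2 * (min δ 1 / 2))
    simpa [φ, r, mul_assoc] using this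
  have hK : ∀ x, ‖fderiv ℝ u x‖ ≤ K := fun x => norm_fderiv_le_of_lipschitz ℝ hu
  have hdm : AEStronglyMeasurable (fderiv ℝ u) (volume : Measure (Pt d)) :=
    (measurable_fderiv ℝ u).aestronglyMeasurable
  have hdi : LocallyIntegrable (fderiv ℝ u) (volume : Measure (Pt d)) := by
    refine (locallyIntegrable_const (K : ℝ)).mono hdm (Eventually.of_forall fun x => ?_)
    simpa using hK x
  have hfd : ∀ n x, fderiv ℝ (mollify (φ n) u) x = _ := fun n x =>
    (hasFDerivAt_mollify (φ n) hu x).fderiv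
  refine InH1.of_tendsto (u := fun n => mollify (φ n) u)
    (g := fun n => fderiv ℝ (mollify (φ n) u)) (A := A + K) (B := K)
    (fun n => ?_) (fun n x hx => ?_) (fun n x _ => ?_) (fun x _ => ?_) ?_
  · refine InH1.of_contDiff ?_ fun x hx => ?_
    · exact (φ n).hasCompactSupport_normed.contDiff_convolution_left _ (φ n).contDiff_normed
        hu.continuous.locallyIntegrable
    · have hxu : u x = 0 := h0 x hx x (by simpa using hδ)
      rw [mollify, ContDiffBump.normed_convolution_eq_right, hxu]
      intro y hy
      rw [hxu]
      exact h0 x hx y ((Metric.mem_ball.1 hy).trans_le ((hr1 n).trans (min_le_left _ _)))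
  · have h1 : dist (mollify (φ n) u x) (u x) ≤ K := by
      refine ContDiffBump.dist_normed_convolution_le hu.continuous.aestronglyMeasurable
        fun y hy => ?_
      refine (hu.dist_le_mul y x).trans (mul_le_of_le_one_right K.2 ?_)
      exact (Metric.mem_ball.1 hy).le.trans ((hr1 n).trans (min_le_right _ _))
    have h2 := norm_sub_norm_le (mollify (φ n) u x) (u x)
    rw [dist_eq_norm] at h1
    linarith [hA x hx]
  · rw [hfd, ← dist_zero_right]
    refine dist_convolution_le K.2 (φ n).support_normed_eq.subset (φ n).nonneg_normed
      (φ n).integral_normed hdm fun y _ => ?_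
    rw [dist_zero_right]
    exact hK y
  · exact ContDiffBump.convolution_tendsto_right_of_continuous hφ hu.continuous x
  · refine ae_restrict_of_ae ?_
    simp_rw [hfd]
    exact ContDiffBump.ae_convolution_tendsto_right_of_locallyIntegrable (K := 2) hφ
      (Eventually.of_forall fun n => le_rfl) hdi

/-! ### Truncation -/

/-- Soft thresholding. -/
def shrink (ε t : ℝ) : ℝ := t - max (-ε) (min ε t)

theorem shrink_of_abs_le {ε t : ℝ} (h : |t| ≤ ε) : shrink ε t = 0 := by
  obtain ⟨h1, h2⟩ := abs_le.1 h
  rw [shrink, min_eq_right h2, max_eq_right h1, sub_self]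

theorem abs_shrink_sub_le {ε : ℝ} (hε : 0 ≤ ε) (t : ℝ) : |shrink ε t - t| ≤ ε := by
  rw [shrink, sub_sub_cancel_left, abs_neg, abs_le]
  exact ⟨le_max_left _ _, max_le (by linarith) (min_le_left _ _)⟩

theorem shrink_of_lt {ε t : ℝ} (hε : 0 ≤ ε) (h : ε < t) : shrink ε t = t - ε := by
  rw [shrink, min_eq_left h.le, max_eq_right (by linarith)]

theorem shrink_of_lt_neg {ε t : ℝ} (hε : 0 ≤ ε) (h : t < -ε) : shrink ε t = t + ε := by
  rw [shrink, min_eq_right (by linarith), max_eq_left h.le, sub_neg_eq_add]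

theorem lipschitz_shrink {u : Pt d → ℝ} {K : NNReal} (hu : LipschitzWith K u) (ε : ℝ) :
    LipschitzWith (K + K) (fun x => shrink ε (u x)) :=
  hu.sub ((hu.const_min ε).const_max (-ε))

-- Near γ one has |u| ≤ K · dist, so soft thresholding at ε makes `u` vanish within ε / (K + 1) of
-- γ, where the previous approximation applies; then ε → 0.
open Filter Topology in
theorem InH1.of_lipschitz {u : Pt d → ℝ} {K : NNReal} (hu : LipschitzWith K u)
    (h0 : ∀ x ∈ γ, u x = 0) : ∃ g, InH1 Ω γ u g := by
  classical
  obtain ⟨A, hA⟩ := exists_bound_of_continuous Ω hu.continuous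
  let ε : ℕ → ℝ := fun n => 1 / ((n : ℝ) + 1)
  have hε0 : ∀ n, 0 < ε n := fun n => by positivity
  have hε1 : ∀ n, ε n ≤ 1 := fun n => by
    simp only [ε]
    rw [div_le_one (by positivity)]
    linarith [n.cast_nonneg (α := ℝ)]
  have hε : Tendsto ε atTop (𝓝 0) := tendsto_one_div_add_atTop_nhds_zero_nat
  -- Where u ≠ 0, the thresholded function is locally u ± ε for small ε and has the gradient of `u`.
  -- Where u = 0 it vanishes near the point for every ε, so the limit gradient there is 0, whatever
  -- `fderiv` gives.
  refine ⟨fun x => if u x = 0 then 0 else fderiv ℝ u x, InH1.of_tendsto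
    (u := fun n x => shrink (ε n) (u x)) (g := fun n => fderiv ℝ (fun x => shrink (ε n) (u x)))
    (A := A + 1) (B := (K + K : NNReal)) (fun n => ?_) (fun n x hx => ?_) (fun n x _ => ?_)
    (fun x _ => ?_) (Eventually.of_forall fun x => ?_)⟩
  · refine InH1.of_lipschitz_of_eventually (lipschitz_shrink hu (ε n))
      (δ := ε n / (K + 1)) (by have := hε0 n; positivity) fun x hx y hy => ?_
    refine shrink_of_abs_le ?_
    have h1 := hu.dist_le_mul y x
    rw [h0 x hx, Real.dist_eq, sub_zero] at h1
    rw [lt_div_iff₀ (by positivity)] at hy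
    nlinarith [dist_nonneg (x := y) (y := x), K.2]
  · have h1 := abs_shrink_sub_le (hε0 n).le (u x)
    have h2 := norm_sub_norm_le (shrink (ε n) (u x)) (u x)
    rw [← Real.norm_eq_abs] at h1
    linarith [hA x hx, hε1 n]
  · exact norm_fderiv_le_of_lipschitz ℝ (lipschitz_shrink hu (ε n))
  · rw [tendsto_iff_dist_tendsto_zero]
    exact squeeze_zero (fun _ => dist_nonneg) (fun n => abs_shrink_sub_le (hε0 n).le (u x)) hε
  · refine tendsto_const_nhds.congr' ?_
    have hc := hu.continuous.tendsto x
    rcases lt_trichotomy (u x) 0 with hx | hx | hx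
    · filter_upwards [hε.eventually (gt_mem_nhds (neg_pos.2 hx))] with n hn
      have h1 : (fun y => shrink (ε n) (u y)) =ᶠ[𝓝 x] fun y => u y + ε n := by
        filter_upwards [hc.eventually (gt_mem_nhds (lt_neg_of_lt_neg hn))] with y hy
        exact shrink_of_lt_neg (hε0 n).le hy
      rw [h1.fderiv_eq, fderiv_add_const, if_neg hx.ne]
    · refine Eventually.of_forall fun n => ?_
      have h1 : (fun y => shrink (ε n) (u y)) =ᶠ[𝓝 x] fun _ => (0 : ℝ) := by
        have h2 := hc.norm
        rw [hx, norm_zero] at h2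
        filter_upwards [h2.eventually (gt_mem_nhds (hε0 n))] with y hy
        exact shrink_of_abs_le hy.le
      simp [h1.fderiv_eq, hx]
    · filter_upwards [hε.eventually (gt_mem_nhds hx)] with n hn
      have h1 : (fun y => shrink (ε n) (u y)) =ᶠ[𝓝 x] fun y => u y - ε n := by
        filter_upwards [hc.eventually (lt_mem_nhds hn)] with y hy
        exact shrink_of_lt (hε0 n).le hy
      rw [h1.fderiv_eq, fderiv_sub_const, if_neg (ne_of_gt hx)]

/-- Lipschitz functions on the closure of the domain that vanish on `γ` are in `H¹_{0,γ}`. -/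
theorem exists_mem_H10_of_lipschitzOn {u : Pt d → ℝ} {K : NNReal}
    (hu : LipschitzOnWith K u (closure Ω.carrier)) (hγ : γ ⊆ closure Ω.carrier)
    (h0 : ∀ x ∈ γ, u x = 0) : ∃ f ∈ H10 Ω γ, f =ᵐ[volume.restrict Ω.carrier] u := by
  obtain ⟨w, hw, hwu⟩ := hu.extend_real
  obtain ⟨g, hg⟩ := InH1.of_lipschitz (Ω := Ω) (γ := γ) hw fun x hx => by
    rw [← hwu (hγ hx), h0 x hx]
  obtain ⟨f, hf, hfw⟩ := hg.exists_mem_H10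
  refine ⟨f, hf, ?_⟩
  filter_upwards [hfw, ae_restrict_mem Ω.isOpen.measurableSet] with x hx hxΩ
  rw [hx, hwu (subset_closure hxΩ)]

end H1

end

section

variable {d : ℕ}

/-! ### Traces -/

/-- The points at height in `(0, h]` (with respect to `a`) above the disc with center `c` and
radius `r`, in the direction `w`. -/
def slab (a : StrongDual ℝ (Pt d)) (c w : Pt d) (r h : ℝ) : Set (Pt d) :=
  {x | ‖x - c - a (x - c) • w‖ < r ∧ a (x - c) ∈ Ioc 0 h}

section slab

variable {a : StrongDual ℝ (Pt d)} {c w : Pt d} {r h : ℝ}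

theorem continuous_slab_base (a : StrongDual ℝ (Pt d)) (c w : Pt d) :
    Continuous fun x => ‖x - c - a (x - c) • w‖ := by fun_prop

theorem continuous_slab_height (a : StrongDual ℝ (Pt d)) (c : Pt d) :
    Continuous fun x => a (x - c) := by fun_prop

theorem measurableSet_slab : MeasurableSet (slab a c w r h) :=
  (measurableSet_lt (continuous_slab_base a c w).measurable measurable_const).inter
    ((continuous_slab_height a c).measurable measurableSet_Ioc)

theorem norm_sub_lt_of_mem_slab {x : Pt d} (hx : x ∈ slab a c w r h) :
    ‖x - c‖ < r + h * ‖w‖ := by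
  obtain ⟨h1, h2, h3⟩ := hx
  have h4 := norm_add_le (x - c - a (x - c) • w) (a (x - c) • w)
  rw [sub_add_cancel, norm_smul, Real.norm_of_nonneg h2.le] at h4
  have := mul_le_mul_of_nonneg_right h3 (norm_nonneg w)
  linarith

theorem height_sub (haw : a w = 1) (x : Pt d) (s : ℝ) :
    a (x - s • w - c) = a (x - c) - s := by
  rw [sub_right_comm, map_sub, map_smul, haw, smul_eq_mul, mul_one]

theorem sub_smul_mem_slab (haw : a w = 1) {x : Pt d} {s : ℝ}
    (h1 : ‖x - c - a (x - c) • w‖ < r) (h2 : a (x - c) - s ∈ Ioc 0 h) :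
    x - s • w ∈ slab a c w r h := by
  refine ⟨?_, by rwa [height_sub haw]⟩
  rw [height_sub haw, sub_smul]
  convert h1 using 2
  abel

/-- The slab is covered by `n` translates of the slab that is `n` times thinner. This bounds the
thin volume from below by a multiple of 1/n without computing either volume. -/
theorem volume_slab_le (haw : a w = 1) (hh : 0 < h) {n : ℕ} (hn : n ≠ 0) :
    volume (slab a c w r h) ≤ n * volume (slab a c w r (h / n)) := by
  have hn' : (0 : ℝ) < n := by positivity
  have hsub : slab a c w r h ⊆
      ⋃ j ∈ Finset.range n, (fun x => x - ((j : ℝ) * (h / n)) • w) ⁻¹' slab a c w r (h / n) := by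
    intro x hx
    obtain ⟨h1, h2, h3⟩ := hx
    set t := a (x - c) with ht
    have hq : 0 < t * n / h := by positivity
    have hc : 0 < ⌈t * n / h⌉₊ := Nat.ceil_pos.2 hq
    have hc1 : t * n / h ≤ ⌈t * n / h⌉₊ := Nat.le_ceil _
    have hc2 : (⌈t * n / h⌉₊ : ℝ) < t * n / h + 1 := Nat.ceil_lt_add_one hq.le
    have hcn : ⌈t * n / h⌉₊ ≤ n := by
      rw [Nat.ceil_le, div_le_iff₀ hh]
      nlinarith
    simp only [mem_iUnion, mem_preimage, Finset.mem_range, exists_prop]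
    -- Heights lie in half-open intervals closed at the top, so a height in (j h/n, (j+1) h/n]
    -- belongs to layer j, which is the ceiling minus one.
    refine ⟨⌈t * n / h⌉₊ - 1, by omega, sub_smul_mem_slab haw h1 ?_⟩
    rw [← ht, Nat.cast_sub hc, Nat.cast_one]
    have e : t = (t * n / h) * (h / n) := by field_simp
    have hpos : 0 < h / n := by positivity
    constructor
    · have := mul_lt_mul_of_pos_right hc2 hpos
      linarith
    · have := mul_le_mul_of_nonneg_right hc1 hpos.le
      linarith
  refine (measure_mono hsub).trans ((measure_biUnion_finset_le _ _).trans ?_)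
  have : ∀ y : Pt d, volume ((fun x => x - y) ⁻¹' slab a c w r (h / n)) =
      volume (slab a c w r (h / n)) := fun y =>
    (measurePreserving_sub_right volume y).measure_preimage measurableSet_slab.nullMeasurableSet
  simp [this]

theorem volume_slab_pos (haw : a w = 1) (hr : 0 < r) (hh : 0 < h) :
    0 < volume (slab a c w r h) := by
  have ho : IsOpen {x | ‖x - c - a (x - c) • w‖ < r ∧ a (x - c) ∈ Ioo 0 h} :=
    (isOpen_lt (continuous_slab_base a c w) continuous_const).inter
      (isOpen_Ioo.preimage (continuous_slab_height a c))
  refine (ho.measure_pos volume ⟨c + (h / 2) • w, ?_⟩).trans_le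
    (measure_mono fun x hx => ⟨hx.1, hx.2.1, hx.2.2.le⟩)
  have : a (c + (h / 2) • w - c) = h / 2 := by simp [haw]
  refine ⟨?_, ?_⟩
  · simp [haw, hr]
  · rw [this]
    exact ⟨by linarith, by linarith⟩

theorem volume_slab_ne_top : volume (slab a c w r h) ≠ ⊤ := by
  refine (measure_mono fun x hx => ?_).trans_lt
    (measure_ball_lt_top (μ := volume) (x := c) (r := r + h * ‖w‖)) |>.ne
  rw [Metric.mem_ball, dist_eq_norm]
  exact norm_sub_lt_of_mem_slab hx

/-- Poincaré's inequality for functions that vanish at the bottom of a slab. -/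
theorem lintegral_slab_le (haw : a w = 1) {v : Pt d → ℝ} (hv : ContDiff ℝ (⊤ : ℕ∞) v)
    (h0 : ∀ x, ‖x - c‖ < r → a (x - c) = 0 → v x = 0) :
    ∫⁻ x in slab a c w r h, ‖v x‖ₑ ≤
      ENNReal.ofReal h * ‖w‖ₑ * ∫⁻ x in slab a c w r h, ‖fderiv ℝ v x‖ₑ := by
  set Q := slab a c w r h with hQ
  have hQm : MeasurableSet Q := measurableSet_slab
  have hc : Continuous (fderiv ℝ v) := hv.continuous_fderiv (by simp)
  have hF : Measurable (Q.indicator fun x => ‖fderiv ℝ v x‖ₑ) :=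
    hc.measurable.enorm.indicator hQm
  -- Fundamental theorem of calculus along -w from `x` down to the bottom, where `v` vanishes. The
  -- bottom point is not in `Q`, hence the open interval in the proof; the indicator allows the
  -- range of `s` to be enlarged to one that does not depend on `x`.
  have hpt : ∀ x ∈ Q, ‖v x‖ₑ ≤
      ∫⁻ s in Ioc 0 h, (Q.indicator fun x => ‖fderiv ℝ v x‖ₑ) (x - s • w) * ‖w‖ₑ := by
    intro x hx
    obtain ⟨h1, h2, h3⟩ := hx
    set t := a (x - c) with ht
    have hd : ∀ s : ℝ, HasDerivAt (fun s => v (x - s • w)) (fderiv ℝ v (x - s • w) (-w)) s := by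
      intro s
      have e1 : HasDerivAt (fun s : ℝ => x - s • w) (-w) s := by
        simpa using ((hasDerivAt_id s).smul_const w).const_sub x
      exact ((hv.differentiable (by simp)) (x - s • w)).hasFDerivAt.comp_hasDerivAt s e1
    have hdc : Continuous fun s : ℝ => fderiv ℝ v (x - s • w) (-w) := by fun_prop
    have hftc := intervalIntegral.integral_eq_sub_of_hasDerivAt (a := 0) (b := t)
      (fun s _ => hd s) (hdc.intervalIntegrable _ _)
    have hvt : v (x - t • w) = 0 := by
      refine h0 _ ?_ ?_
      · convert h1 using 2
        abel
      · rw [height_sub haw, sub_self]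
    rw [hvt, zero_smul, sub_zero, zero_sub, intervalIntegral.integral_of_le h2.le,
      integral_Ioc_eq_integral_Ioo] at hftc
    rw [← enorm_neg, ← hftc]
    refine (enorm_integral_le_lintegral_enorm _).trans ?_
    calc ∫⁻ s in Ioo 0 t, ‖fderiv ℝ v (x - s • w) (-w)‖ₑ
        ≤ ∫⁻ s in Ioo 0 t, (Q.indicator fun x => ‖fderiv ℝ v x‖ₑ) (x - s • w) * ‖w‖ₑ := by
          refine setLIntegral_mono' measurableSet_Ioo fun s hs => ?_
          have hmem : x - s • w ∈ Q :=
            sub_smul_mem_slab haw h1 ⟨by linarith [hs.2], by linarith [hs.1]⟩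
          rw [indicator_of_mem hmem, ← enorm_neg w]
          exact ContinuousLinearMap.le_opENorm _ _
      _ ≤ _ := lintegral_mono_set (Ioo_subset_Ioc_self.trans (Ioc_subset_Ioc_right h3))
  -- After Tonelli, the integral over x is translation invariant for each fixed s, so integrating
  -- over s contributes only the factor h.
  calc ∫⁻ x in Q, ‖v x‖ₑ
      ≤ ∫⁻ x in Q, ∫⁻ s in Ioc 0 h,
          (Q.indicator fun x => ‖fderiv ℝ v x‖ₑ) (x - s • w) * ‖w‖ₑ :=
        setLIntegral_mono' hQm hpt
    _ ≤ ∫⁻ x, ∫⁻ s in Ioc 0 h,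
          (Q.indicator fun x => ‖fderiv ℝ v x‖ₑ) (x - s • w) * ‖w‖ₑ := setLIntegral_le_lintegral _ _
    _ = ∫⁻ s in Ioc 0 h, ∫⁻ x,
          (Q.indicator fun x => ‖fderiv ℝ v x‖ₑ) (x - s • w) * ‖w‖ₑ := by
        refine lintegral_lintegral_swap (Measurable.aemeasurable ?_)
        refine (hF.comp ?_).mul_const _
        exact measurable_fst.sub (measurable_snd.smul_const w)
    _ = ∫⁻ s in Ioc 0 h, (∫⁻ x, (Q.indicator fun x => ‖fderiv ℝ v x‖ₑ) x) * ‖w‖ₑ := by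
        refine lintegral_congr fun s => ?_
        have hFs : Measurable fun x : Pt d =>
            (Q.indicator fun x => ‖fderiv ℝ v x‖ₑ) (x - s • w) :=
          hF.comp (measurable_id.sub_const _)
        rw [lintegral_mul_const _ hFs]
        congr 1
        exact lintegral_sub_right_eq_self (Q.indicator fun x => ‖fderiv ℝ v x‖ₑ) (s • w)
    _ = _ := by
        rw [lintegral_indicator hQm, setLIntegral_const, Real.volume_Ioc, sub_zero]
        ring

end slab

section trace

variable {Ω : PolytopalDomain d} {γ : Set (Pt d)}

/-- For smooth functions vanishing on γ this is Poincaré's inequality in the slab followed by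
Cauchy–Schwarz. Both sides are continuous in the pair (u, ∇u), so the estimate passes to the
closure. -/
theorem abs_setIntegral_slab_le {a : StrongDual ℝ (Pt d)} {c w : Pt d} {r h : ℝ} (haw : a w = 1)
    (hh : 0 ≤ h) (hQ : slab a c w r h ⊆ Ω.carrier)
    (h0 : ∀ x, ‖x - c‖ < r → a (x - c) = 0 → x ∈ γ)
    {p : Lp ℝ 2 (volume.restrict Ω.carrier) ×
      Lp (StrongDual ℝ (Pt d)) 2 (volume.restrict Ω.carrier)}
    (hp : p ∈ (smoothGraph Ω γ).topologicalClosure) :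
    |∫ x in slab a c w r h, p.1 x| ≤
      h * ‖w‖ * Real.sqrt (volume.real (slab a c w r h)) * ‖p.2‖ := by
  set Q := slab a c w r h with hQdef
  have hQm : MeasurableSet Q := measurableSet_slab
  have hQt : volume Q ≠ ⊤ := volume_slab_ne_top
  have hrr : (volume.restrict Ω.carrier).restrict Q = volume.restrict Q := by
    rw [Measure.restrict_restrict hQm, inter_eq_self_of_subset_left hQ]
  have hQt' : (volume.restrict Ω.carrier) Q ≠ ⊤ :=
    ((Measure.restrict_apply_le _ _).trans_lt hQt.lt_top).ne
  have hint : ∀ f : Lp ℝ 2 (volume.restrict Ω.carrier),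
      inner ℝ (indicatorConstLp 2 hQm hQt' (1 : ℝ)) f = ∫ x in Q, f x := fun f => by
    rw [L2.inner_indicatorConstLp_one, hrr]
  rw [← hint]
  have hclosed : IsClosed {p : Lp ℝ 2 (volume.restrict Ω.carrier) ×
      Lp (StrongDual ℝ (Pt d)) 2 (volume.restrict Ω.carrier) |
      |inner ℝ (indicatorConstLp 2 hQm hQt' (1 : ℝ)) p.1| ≤
        h * ‖w‖ * Real.sqrt (volume.real Q) * ‖p.2‖} :=
    isClosed_le (continuous_const.inner continuous_fst).abs
      (continuous_const.mul continuous_snd.norm)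
  refine closure_minimal ?_ hclosed hp
  rintro q ⟨v, hv, hv0, hq1, hq2⟩
  have hae1 : q.1 =ᵐ[volume.restrict Q] v := by
    rw [← hrr]
    exact ae_restrict_of_ae hq1
  have hae2 : q.2 =ᵐ[volume.restrict Q] fderiv ℝ v := by
    rw [← hrr]
    exact ae_restrict_of_ae hq2
  rw [mem_ofPred_eq, hint, ← Real.norm_eq_abs]
  have hc : Continuous (fderiv ℝ v) := hv.continuous_fderiv (by simp)
  have hpoin := lintegral_slab_le (h := h) haw hv (fun x hx hx' => hv0 x (h0 x hx hx'))
  rw [← hQdef] at hpoin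
  have hhold : ∫⁻ x in Q, ‖fderiv ℝ v x‖ₑ ≤
      ENNReal.ofReal ‖q.2‖ * ENNReal.ofReal (Real.sqrt (volume.real Q)) := by
    have e1 := eLpNorm_le_eLpNorm_mul_rpow_measure_univ (μ := volume.restrict Q) (p := 1) (q := 2)
      (by norm_num) (hc.aestronglyMeasurable (μ := volume.restrict Q))
    rw [eLpNorm_one_eq_lintegral_enorm] at e1
    refine e1.trans (mul_le_mul' ?_ ?_)
    · rw [Lp.norm_def, ENNReal.ofReal_toReal (Lp.eLpNorm_ne_top _), ← eLpNorm_congr_ae hae2, ← hrr]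
      exact eLpNorm_mono_measure _ Measure.restrict_le_self
    · rw [Measure.restrict_apply_univ, Real.sqrt_eq_rpow, measureReal_def,
        ← ENNReal.ofReal_rpow_of_nonneg ENNReal.toReal_nonneg (by norm_num),
        ENNReal.ofReal_toReal hQt]
      norm_num
  have hfin : ‖∫ x in Q, q.1 x‖ₑ ≤
      ENNReal.ofReal (h * ‖w‖ * Real.sqrt (volume.real Q) * ‖q.2‖) := by
    rw [integral_congr_ae hae1]
    refine (enorm_integral_le_lintegral_enorm _).trans (hpoin.trans ?_)
    refine (mul_le_mul_right hhold _).trans (le_of_eq ?_)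
    rw [← ofReal_norm w, ← ENNReal.ofReal_mul hh, ← ENNReal.ofReal_mul (norm_nonneg _),
      ← ENNReal.ofReal_mul (by positivity)]
    congr 1
    ring
  rw [← ofReal_norm] at hfin
  exact (ENNReal.ofReal_le_ofReal_iff (by positivity)).1 hfin

/-- A function in `H¹_{0,γ}` that is continuous up to the boundary vanishes at the points near
which `γ` is a hyperplane with the domain on one side of it. -/
theorem eq_zero_of_mem_H10 {a : StrongDual ℝ (Pt d)} {c w : Pt d} {ρ : ℝ} (hρ : 0 < ρ)
    (haw : a w = 1) (h1 : ∀ x, ‖x - c‖ < ρ → 0 < a (x - c) → x ∈ Ω.carrier)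
    (h0 : ∀ x, ‖x - c‖ < ρ → a (x - c) = 0 → x ∈ γ) {u : Pt d → ℝ}
    (hcc : c ∈ closure Ω.carrier) (hu : ContinuousOn u (closure Ω.carrier))
    {f : Lp ℝ 2 (volume.restrict Ω.carrier)} (hf : f ∈ H10 Ω γ)
    (hfu : f =ᵐ[volume.restrict Ω.carrier] u) : u c = 0 := by
  by_contra hne
  obtain ⟨p, hp, rfl⟩ := hf
  obtain ⟨ρ', hρ'0, hρ'⟩ := Metric.continuousWithinAt_iff.1 (hu c hcc) (|u c| / 2)
    (by positivity)
  set m := |u c| / 2 with hm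
  have hm0 : 0 < m := by positivity
  -- With h ‖w‖ ≤ r, the slabs stay in the ball of radius `min ρ ρ'`, where the local geometry is
  -- known and |u - u c| < m = |u c| / 2.
  set r := min ρ ρ' / 2 with hr
  have hr0 : 0 < r := by have := lt_min hρ hρ'0; positivity
  set h := r / (‖w‖ + 1) with hh
  have hh0 : 0 < h := by positivity
  have hhw : h * ‖w‖ ≤ r := by
    rw [hh, div_mul_eq_mul_div, div_le_iff₀ (by positivity)]
    nlinarith [norm_nonneg w]
  set κ := volume.real (slab a c w r h) with hκ
  have hκ0 : 0 < κ := ENNReal.toReal_pos (volume_slab_pos haw hr0 hh0).ne' volume_slab_ne_top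
  -- On the slab of thickness h/n and volume q, the integral of `u` is at least m q in absolute
  -- value and at most (h/n) ‖w‖ √q ‖p.2‖. Since q ≥ κ/n, squaring bounds `n`, which is absurd for
  -- large `n`.
  have key : ∀ n : ℕ, n ≠ 0 → m ^ 2 * κ * n ≤ h ^ 2 * ‖w‖ ^ 2 * ‖p.2‖ ^ 2 := by
    intro n hn
    have hn' : (1 : ℝ) ≤ n := by exact_mod_cast Nat.one_le_iff_ne_zero.2 hn
    have hhn : 0 < h / n := by positivity
    have hhnle : h / n ≤ h := div_le_self hh0.le hn'
    have hball : ∀ x ∈ slab a c w r (h / n), ‖x - c‖ < min ρ ρ' := fun x hx => by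
      have e1 := norm_sub_lt_of_mem_slab hx
      have e2 := mul_le_mul_of_nonneg_right hhnle (norm_nonneg w)
      have e3 : min ρ ρ' = r + r := by rw [hr]; ring
      linarith
    have hQ : slab a c w r (h / n) ⊆ Ω.carrier := fun x hx =>
      h1 x ((hball x hx).trans_le (min_le_left _ _)) hx.2.1
    have hbound := abs_setIntegral_slab_le (Ω := Ω) (γ := γ) haw hhn.le hQ
      (fun x hx => h0 x (hx.trans_le (by
        rw [hr]
        have := min_le_left ρ ρ'
        linarith [lt_min hρ hρ'0]))) hp
    have hQt : volume (slab a c w r (h / n)) ≠ ⊤ := volume_slab_ne_top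
    have hae : p.1 =ᵐ[volume.restrict (slab a c w r (h / n))] u :=
      ae_restrict_of_ae_restrict_of_subset hQ hfu
    rw [integral_congr_ae hae] at hbound
    set q := volume.real (slab a c w r (h / n)) with hq
    have hq0 : 0 ≤ q := measureReal_nonneg
    have hlow : m * q ≤ |∫ x in slab a c w r (h / n), u x| := by
      have e1 : ‖∫ x in slab a c w r (h / n), (u x - u c)‖ ≤ m * q := by
        refine norm_setIntegral_le_of_norm_le_const hQt.lt_top fun x hx => ?_
        have := hρ' (subset_closure (hQ hx))
          (by rw [dist_eq_norm]; exact (hball x hx).trans_le (min_le_right _ _))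
        rw [dist_eq_norm] at this
        exact this.le
      have hui : IntegrableOn u (slab a c w r (h / n)) := by
        have : MemLp p.1 2 (volume.restrict Ω.carrier) := Lp.memLp _
        have e2 := (this.integrable (by norm_num)).mono_measure
          (Measure.restrict_mono hQ le_rfl)
        exact e2.congr hae
      rw [integral_sub hui (integrableOn_const hQt), setIntegral_const, ← hq, smul_eq_mul,
        Real.norm_eq_abs] at e1
      have e3 := abs_sub_abs_le_abs_sub (q * u c) (∫ x in slab a c w r (h / n), u x)
      rw [abs_mul, abs_of_nonneg hq0, abs_sub_comm] at e3
      have e4 : |u c| = 2 * m := by rw [hm]; ring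
      rw [e4] at e3
      linarith
    have hκq : κ ≤ n * q := by
      have := ENNReal.toReal_mono (ENNReal.mul_ne_top (ENNReal.natCast_ne_top n) hQt)
        (volume_slab_le (c := c) (r := r) haw hh0 hn)
      rwa [ENNReal.toReal_mul, ENNReal.toReal_natCast] at this
    have hqpos : 0 < q := by
      by_contra hle
      nlinarith
    have hs := Real.sq_sqrt hq0
    have hs0 : 0 < Real.sqrt q := Real.sqrt_pos.2 hqpos
    have e5 : m * Real.sqrt q ≤ h / n * ‖w‖ * ‖p.2‖ := by
      refine le_of_mul_le_mul_right ?_ hs0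
      calc m * Real.sqrt q * Real.sqrt q = m * q := by rw [mul_assoc, Real.mul_self_sqrt hq0]
        _ ≤ _ := hlow.trans hbound
        _ = _ := by ring
    have e6 : m ^ 2 * q ≤ (h / n * ‖w‖ * ‖p.2‖) ^ 2 := by
      rw [← hs, ← mul_pow]
      gcongr
    have hn0 : (0 : ℝ) < n := by linarith
    calc m ^ 2 * κ * n ≤ m ^ 2 * (n * q) * n := by gcongr
      _ = (m ^ 2 * q) * n ^ 2 := by ring
      _ ≤ (h / n * ‖w‖ * ‖p.2‖) ^ 2 * n ^ 2 := by gcongr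
      _ = _ := by field_simp
  obtain ⟨n, hn⟩ := exists_nat_gt (h ^ 2 * ‖w‖ ^ 2 * ‖p.2‖ ^ 2 / (m ^ 2 * κ))
  have hn0 : n ≠ 0 := by
    rintro rfl
    have : 0 ≤ h ^ 2 * ‖w‖ ^ 2 * ‖p.2‖ ^ 2 / (m ^ 2 * κ) := by positivity
    rw [Nat.cast_zero] at hn
    linarith
  rw [div_lt_iff₀ (by positivity)] at hn
  linarith [key n hn0]

variable (T : Triangulation Ω)

theorem Triangulation.isSimplex {S : Finset (Pt d)} (hS : S ∈ T.cells) : IsSimplex S :=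
  ⟨T.card_eq S hS, T.affineIndependent S hS⟩

theorem Triangulation.hull_subset {S : Finset (Pt d)} (hS : S ∈ T.cells) :
    hull S ⊆ closure Ω.carrier := by
  rw [← T.cover]
  exact subset_biUnion_of_mem (u := fun S => hull S) (Finset.mem_coe.2 hS)

/-- The absence of cracks enters here: an open subset of the closure lies in the domain because the
domain is the interior of its closure. -/
theorem Triangulation.interior_hull_subset {S : Finset (Pt d)} (hS : S ∈ T.cells) :
    interior (hull S) ⊆ Ω.carrier := by
  rw [← Ω.interior_closure]
  exact interior_mono (T.hull_subset hS)

theorem Triangulation.IsBoundaryPart.subset_closure {γ : Set (Pt d)} (hγ : T.IsBoundaryPart γ) :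
    γ ⊆ closure Ω.carrier :=
  hγ.1.trans frontier_subset_closure

/-- At a relative interior point of a facet, the barycentric coordinate of the opposite vertex `p`
serves as height. The other coordinates stay positive nearby, so positive height means the interior
of the simplex and zero height means the facet, as `eq_zero_of_mem_H10` requires. -/
theorem eq_zero_of_pos_barycentric {S f : Finset (Pt d)} (hS : S ∈ T.cells) (hfS : f ⊆ S)
    (hfc : f.card = d) (hfγ : hull f ⊆ γ) {u : Pt d → ℝ}
    (hu : ContinuousOn u (closure Ω.carrier)) {F : Lp ℝ 2 (volume.restrict Ω.carrier)}
    (hF : F ∈ H10 Ω γ) (hFu : F =ᵐ[volume.restrict Ω.carrier] u) {k : Pt d → ℝ}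
    (hk0 : ∀ v ∈ f, 0 < k v) (hk1 : ∑ v ∈ f, k v = 1) : u (∑ v ∈ f, k v • v) = 0 := by
  classical
  have hSs := T.isSimplex hS
  obtain ⟨b, hb1, hb0, hbs, hbx⟩ := hSs.exists_barycentric
  obtain ⟨p, hp⟩ : ∃ p, S \ f = {p} := by
    rw [← Finset.card_eq_one, Finset.card_sdiff_of_subset hfS, hSs.card_eq, hfc]
    omega
  have hpS : p ∈ S := (Finset.mem_sdiff.1 (hp ▸ Finset.mem_singleton_self p)).1
  have hpf : p ∉ f := (Finset.mem_sdiff.1 (hp ▸ Finset.mem_singleton_self p)).2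
  have hSf : S = insert p f := by
    rw [Finset.insert_eq, ← hp, Finset.sdiff_union_of_subset hfS]
  set c := ∑ v ∈ f, k v • v with hc
  have hcf : c ∈ hull f := by
    rw [hull, Finset.mem_convexHull']
    exact ⟨k, fun v hv => (hk0 v hv).le, hk1, rfl⟩
  have hbc : ∀ v ∈ f, b v c = k v := by
    intro v hv
    rw [hc, affineMap_sum (b v) f k _ hk1, Finset.sum_eq_single v
      (fun w hw hne => by rw [hb0 v (hfS hv) w (hfS hw) hne, smul_zero]) (fun h => absurd hv h),
      hb1 v (hfS hv), smul_eq_mul, mul_one]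
  have hbpc : b p c = 0 := by
    rw [hc, affineMap_sum (b p) f k _ hk1]
    refine Finset.sum_eq_zero fun w hw => ?_
    rw [hb0 p hpS w (hfS hw) (fun h => hpf (h ▸ hw)), smul_zero]
  have hbcont : ∀ v, Continuous (b v) := fun v => (b v).continuous_of_finiteDimensional
  let a : StrongDual ℝ (Pt d) := LinearMap.toContinuousLinearMap (b p).linear
  have ha : ∀ x, a (x - c) = b p x := fun x => by
    have := (b p).linearMap_vsub x c
    rw [vsub_eq_sub, vsub_eq_sub, hbpc, sub_zero] at this
    exact this
  have hnear : ∀ᶠ x in nhds c, ∀ v ∈ f, 0 < b v x := by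
    rw [Filter.eventually_all_finset]
    intro v hv
    refine ((hbcont v).tendsto c).eventually (lt_mem_nhds ?_)
    rw [hbc v hv]
    exact hk0 v hv
  obtain ⟨ρ, hρ, hρb⟩ := Metric.eventually_nhds_iff.1 hnear
  simp_rw [dist_eq_norm] at hρb
  refine eq_zero_of_mem_H10 (a := a) (c := c) (w := p - c) hρ (by rw [ha, hb1 p hpS])
    (fun x hx hx0 => ?_) (fun x hx hx0 => ?_) (T.hull_subset hS (hull_mono hfS hcf)) hu hF hFu
  · rw [ha] at hx0
    refine T.interior_hull_subset hS ?_
    have ho : IsOpen {y | ∀ v ∈ S, 0 < b v y} := by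
      simp only [ofPred_forall]
      exact isOpen_biInter_finset fun v _ => isOpen_lt continuous_const (hbcont v)
    refine interior_maximal (fun y hy => ?_) ho ?_
    · rw [hull, Finset.mem_convexHull']
      exact ⟨fun v => b v y, fun v hv => (hy v hv).le, hbs y, hbx y⟩
    · intro v hv
      rw [hSf, Finset.mem_insert] at hv
      rcases hv with rfl | hv
      · exact hx0
      · exact hρb hx v hv
  · rw [ha] at hx0
    refine hfγ ?_
    have e1 := hbs x
    have e2 := hbx x
    rw [hSf, Finset.sum_insert hpf, hx0] at e1 e2
    rw [zero_add] at e1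
    rw [zero_smul, zero_add] at e2
    rw [hull, Finset.mem_convexHull']
    exact ⟨fun v => b v x, fun v hv => (hρb hx v hv).le, e1, e2⟩

open Filter Topology in
/-- Functions in `H¹_{0,γ}` that are continuous up to the boundary vanish on `γ`. -/
theorem eq_zero_on_of_mem_H10 (hγ : T.IsBoundaryPart γ) {u : Pt d → ℝ}
    (hu : ContinuousOn u (closure Ω.carrier)) {F : Lp ℝ 2 (volume.restrict Ω.carrier)}
    (hF : F ∈ H10 Ω γ) (hFu : F =ᵐ[volume.restrict Ω.carrier] u) {y : Pt d} (hy : y ∈ γ) :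
    u y = 0 := by
  obtain ⟨-, fs, hfs, hγf⟩ := hγ
  rw [hγf] at hy
  simp only [mem_iUnion, exists_prop] at hy
  obtain ⟨f, hf, hyf⟩ := hy
  obtain ⟨hfc, S, hS, hfS⟩ := hfs f hf
  have hfγ : hull f ⊆ γ := by
    rw [hγf]
    exact subset_biUnion_of_mem (u := fun S => hull S) (Finset.mem_coe.2 hf)
  have hyf' := hyf
  rw [hull, Finset.mem_convexHull'] at hyf'
  obtain ⟨k, hk0, hk1, rfl⟩ := hyf'
  have hne : f.Nonempty := by
    by_contra h
    rw [Finset.not_nonempty_iff_eq_empty] at h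
    simp [h] at hk1
  have hcard : (0 : ℝ) < f.card := by exact_mod_cast hne.card_pos
  let t : ℕ → ℝ := fun n => 1 / ((n : ℝ) + 1)
  have ht : Tendsto t atTop (𝓝 0) := tendsto_one_div_add_atTop_nhds_zero_nat
  have ht0 : ∀ n, 0 < t n := fun n => by positivity
  have ht1 : ∀ n, t n ≤ 1 := fun n => by
    simp only [t]
    rw [div_le_one (by positivity)]
    linarith [n.cast_nonneg (α := ℝ)]
  -- Moving the point towards the barycentre of the face makes all coordinates positive; continuity
  -- of `u` then carries the zero values back to the point.
  let k' : ℕ → Pt d → ℝ := fun n v => (1 - t n) * k v + t n / f.card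
  have hk'0 : ∀ n, ∀ v ∈ f, 0 < k' n v := fun n v hv =>
    add_pos_of_nonneg_of_pos (mul_nonneg (by linarith [ht1 n]) (hk0 v hv))
      (div_pos (ht0 n) hcard)
  have hk'1 : ∀ n, ∑ v ∈ f, k' n v = 1 := fun n => by
    simp only [k', Finset.sum_add_distrib, ← Finset.mul_sum, hk1, Finset.sum_const, nsmul_eq_mul]
    field_simp
    ring
  have hzero : ∀ n, u (∑ v ∈ f, k' n v • v) = 0 := fun n =>
    eq_zero_of_pos_barycentric T hS hfS hfc hfγ hu hF hFu (hk'0 n) (hk'1 n)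
  have hmem : ∀ n, ∑ v ∈ f, k' n v • v ∈ closure Ω.carrier := fun n => by
    refine T.hull_subset hS (hull_mono hfS ?_)
    rw [hull, Finset.mem_convexHull']
    exact ⟨k' n, fun v hv => (hk'0 n v hv).le, hk'1 n, rfl⟩
  have hlim : Tendsto (fun n => ∑ v ∈ f, k' n v • v) atTop (𝓝 (∑ v ∈ f, k v • v)) := by
    refine tendsto_finsetSum _ fun v _ => ?_
    have : Tendsto (fun n => k' n v) atTop (𝓝 ((1 - 0) * k v + 0 / f.card)) :=
      ((tendsto_const_nhds.sub ht).mul_const _).add (ht.div_const _)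
    rw [sub_zero, one_mul, zero_div, add_zero] at this
    exact this.smul_const v
  have hcy := hu _ (T.hull_subset hS (hull_mono hfS hyf))
  have := hcy.tendsto.comp (tendsto_nhdsWithin_iff.2 ⟨hlim, Eventually.of_forall hmem⟩)
  refine tendsto_nhds_unique this ?_
  simp only [Function.comp_def, hzero]
  exact tendsto_const_nhds

end trace

end

section

variable {d ℓ : ℕ}

/-! ### Piecewise polynomials are Lipschitz -/

theorem norm_sum_smul_sub_le {D m : ℝ} (s : Finset (Pt d)) (r : Pt d → ℝ) (v₀ : Pt d)
    (hr : ∀ v ∈ s, 0 ≤ r v) (hD : ∀ v ∈ s, ‖v - v₀‖ ≤ D) (hm : ∑ v ∈ s, r v = m) :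
    ‖∑ v ∈ s, r v • v - m • v₀‖ ≤ m * D := by
  rw [← hm, Finset.sum_smul, ← Finset.sum_sub_distrib, Finset.sum_mul]
  refine norm_sum_le_of_le _ fun v hv => ?_
  rw [← smul_sub, norm_smul, Real.norm_of_nonneg (hr v hv)]
  exact mul_le_mul_of_nonneg_left (hD v hv) (hr v hv)

open Filter Topology in
/-- Two simplices that meet in a common face are regularly situated. -/
theorem exists_regularly_situated {S S' : Finset (Pt d)}
    (hS : AffineIndependent ℝ ((↑) : S → Pt d)) (hS' : AffineIndependent ℝ ((↑) : S' → Pt d))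
    (hconf : hull S ∩ hull S' ⊆ convexHull ℝ ((S : Set (Pt d)) ∩ (S' : Set (Pt d)))) :
    ∃ C : ℝ, 0 ≤ C ∧ ∀ x ∈ hull S, ∀ y ∈ hull S', 1 ≤ C * ‖x - y‖ ∨
      ∃ z ∈ hull S ∩ hull S', ‖x - z‖ ≤ C * ‖x - y‖ ∧ ‖z - y‖ ≤ C * ‖x - y‖ := by
  classical
  -- A common point would lie in the hull of the shared vertices by conformity, and then, by affine
  -- independence, in the hull of the empty set W ∩ W' ∩ S ∩ S'.
  have hdisj : ∀ W ⊆ S, ∀ W' ⊆ S', Disjoint W W' → Disjoint (hull W) (hull W') := by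
    intro W hW W' hW' hd
    rw [Set.disjoint_left]
    intro z hz hz'
    have h1 := hconf ⟨hull_mono hW hz, hull_mono hW' hz'⟩
    rw [← Finset.coe_inter] at h1
    have hinter : ∀ R : Finset (Pt d), AffineIndependent ℝ ((↑) : R → Pt d) → ∀ A ⊆ R, ∀ B ⊆ R,
        z ∈ hull A → z ∈ hull B → z ∈ hull (A ∩ B) := by
      intro R hR A hA B hB hzA hzB
      rw [hull, Finset.coe_inter, AffineIndependent.convexHull_inter hR hA hB]
      exact ⟨hzA, hzB⟩
    have h2 := hinter S hS W hW (S ∩ S') Finset.inter_subset_left hz h1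
    have h3 := hinter S' hS' W' hW' (S ∩ S') Finset.inter_subset_right hz' h1
    have h4 := hinter S hS _ (Finset.inter_subset_right.trans Finset.inter_subset_left) _
      (Finset.inter_subset_right.trans Finset.inter_subset_left) h2 h3
    have h5 : (W ∩ (S ∩ S')) ∩ (W' ∩ (S ∩ S')) = ∅ := by
      rw [Finset.eq_empty_iff_forall_notMem]
      intro w hw
      simp only [Finset.mem_inter] at hw
      exact Finset.disjoint_left.1 hd hw.1.1 hw.2.1
    simp [h5, hull] at h4
  -- There are finitely many pairs of disjoint faces, each a pair of disjoint compact sets, so one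
  -- separation δ serves them all.
  obtain ⟨δ, hδ0, hδ⟩ : ∃ δ : ℝ, 0 < δ ∧ ∀ W ∈ S.powerset, ∀ W' ∈ S'.powerset, Disjoint W W' →
      ∀ x ∈ hull W, ∀ y ∈ hull W', δ ≤ ‖x - y‖ := by
    have h : ∀ᶠ δ : ℝ in 𝓝[>] 0, ∀ W ∈ S.powerset, ∀ W' ∈ S'.powerset, Disjoint W W' →
        ∀ x ∈ hull W, ∀ y ∈ hull W', δ ≤ ‖x - y‖ := by
      rw [eventually_all_finset]
      intro W hW
      rw [eventually_all_finset]
      intro W' hW'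
      by_cases hd : Disjoint W W'
      · obtain ⟨r, hr0, hr⟩ := Metric.exists_pos_forall_lt_edist (hull_isCompact W)
          (hull_isCompact W').isClosed
          (hdisj W (Finset.mem_powerset.1 hW) W' (Finset.mem_powerset.1 hW') hd)
        filter_upwards [Ioo_mem_nhdsGT (show (0 : ℝ) < r from hr0)] with δ hδ _ x hx y hy
        have := hr x hx y hy
        rw [edist_dist, dist_eq_norm, ← ENNReal.ofReal_coe_nnreal,
          ENNReal.ofReal_lt_ofReal_iff_of_nonneg (NNReal.coe_nonneg r)] at this
        exact (hδ.2.trans this).le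
      · exact Eventually.of_forall fun _ h => absurd h hd
    obtain ⟨δ, h1, h2⟩ := (h.and self_mem_nhdsWithin).exists
    exact ⟨δ, h2, h1⟩
  let D : ℝ := ∑ v ∈ S ∪ S', ∑ w ∈ S ∪ S', ‖v - w‖
  have hD0 : 0 ≤ D := Finset.sum_nonneg fun _ _ => Finset.sum_nonneg fun _ _ => norm_nonneg _
  have hD : ∀ v ∈ S ∪ S', ∀ w ∈ S ∪ S', ‖v - w‖ ≤ D := fun v hv w hw =>
    (Finset.single_le_sum (f := fun w => ‖v - w‖) (fun _ _ => norm_nonneg _) hw).trans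
      (Finset.single_le_sum (f := fun v => ∑ w ∈ S ∪ S', ‖v - w‖)
        (fun _ _ => Finset.sum_nonneg fun _ _ => norm_nonneg _) hv)
  -- `D` bounds the distances between vertices. Below, x and y differ from their shared part by
  -- residuals of mass m with m δ ≤ ‖x - y‖, and relocating such a mass to a vertex costs at most m
  -- D.
  refine ⟨(1 + D) / δ, by positivity, fun x hx y hy => ?_⟩
  rw [hull, Finset.mem_convexHull'] at hx hy
  obtain ⟨a, ha0, ha1, rfl⟩ := hx
  obtain ⟨b, hb0, hb1, rfl⟩ := hy
  set x := ∑ v ∈ S, a v • v with hx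
  set y := ∑ v ∈ S', b v • v with hy
  -- The part common to x and y: the smaller coefficient at each shared vertex. At every shared
  -- vertex one of the residuals a - c and b - c vanishes, so they have disjoint supports; both have
  -- total mass m.
  let c : Pt d → ℝ := fun v => if v ∈ S ∩ S' then min (a v) (b v) else 0
  have hcS : ∀ v ∈ S, 0 ≤ a v - c v := by
    intro v hv
    simp only [c]
    split_ifs with h
    · exact sub_nonneg.2 (min_le_left _ _)
    · simpa using ha0 v hv
  have hcS' : ∀ v ∈ S', 0 ≤ b v - c v := by
    intro v hv
    simp only [c]
    split_ifs with h
    · exact sub_nonneg.2 (min_le_right _ _)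
    · simpa using hb0 v hv
  have hc0 : ∀ v, v ∉ S ∩ S' → c v = 0 := fun v hv => if_neg hv
  have hcpos : ∀ v ∈ S ∩ S', 0 ≤ c v := fun v hv => by
    simp only [c, if_pos hv]
    exact le_min (ha0 v (Finset.mem_inter.1 hv).1) (hb0 v (Finset.mem_inter.1 hv).2)
  have hcsumS : ∀ {V : Type} [AddCommGroup V] [Module ℝ V] (g : Pt d → V),
      ∑ v ∈ S, c v • g v = ∑ v ∈ S ∩ S', c v • g v := fun g =>
    (Finset.sum_subset Finset.inter_subset_left fun v _ hv => by rw [hc0 v hv, zero_smul]).symm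
  have hcsumS' : ∀ {V : Type} [AddCommGroup V] [Module ℝ V] (g : Pt d → V),
      ∑ v ∈ S', c v • g v = ∑ v ∈ S ∩ S', c v • g v := fun g =>
    (Finset.sum_subset Finset.inter_subset_right fun v _ hv => by rw [hc0 v hv, zero_smul]).symm
  set m := 1 - ∑ v ∈ S ∩ S', c v with hm
  have hmS : ∑ v ∈ S, (a v - c v) = m := by
    have := hcsumS (fun _ => (1 : ℝ))
    simp only [smul_eq_mul, mul_one] at this
    rw [Finset.sum_sub_distrib, ha1, this]
  have hmS' : ∑ v ∈ S', (b v - c v) = m := by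
    have := hcsumS' (fun _ => (1 : ℝ))
    simp only [smul_eq_mul, mul_one] at this
    rw [Finset.sum_sub_distrib, hb1, this]
  have hm0 : 0 ≤ m := hmS ▸ Finset.sum_nonneg hcS
  have hxr : ∑ v ∈ S, (a v - c v) • v = x - ∑ v ∈ S ∩ S', c v • v := by
    simp_rw [sub_smul, Finset.sum_sub_distrib]
    rw [hcsumS]
  have hyr : ∑ v ∈ S', (b v - c v) • v = y - ∑ v ∈ S ∩ S', c v • v := by
    simp_rw [sub_smul, Finset.sum_sub_distrib]
    rw [hcsumS']
  -- The residuals divided by m are points of disjoint faces, hence at least δ apart, and their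
  -- difference is (x - y) / m.
  have hlow : m * δ ≤ ‖x - y‖ := by
    rcases hm0.eq_or_lt with h | h
    · rw [← h, zero_mul]
      exact norm_nonneg _
    have hmem : ∀ (R : Finset (Pt d)) (r : Pt d → ℝ), (∀ v ∈ R, 0 ≤ r v) → ∑ v ∈ R, r v = m →
        m⁻¹ • ∑ v ∈ R, r v • v ∈ hull (R.filter fun v => r v ≠ 0) := by
      intro R r hr hrm
      rw [hull, Finset.mem_convexHull']
      refine ⟨fun v => m⁻¹ * r v, fun v hv => mul_nonneg (inv_nonneg.2 hm0)
        (hr v (Finset.mem_filter.1 hv).1), ?_, ?_⟩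
      · rw [← Finset.mul_sum, Finset.sum_filter_ne_zero, hrm, inv_mul_cancel₀ h.ne']
      · rw [Finset.smul_sum, Finset.sum_filter]
        refine Finset.sum_congr rfl fun v _ => ?_
        split_ifs with h0
        · rw [mul_smul]
        · rw [not_not] at h0
          rw [h0, zero_smul, smul_zero]
    have hdist := hδ _ (Finset.mem_powerset.2 (Finset.filter_subset (fun v => a v - c v ≠ 0) S))
      _ (Finset.mem_powerset.2 (Finset.filter_subset (fun v => b v - c v ≠ 0) S'))
      (by
        rw [Finset.disjoint_left]
        intro v hv hv'
        rw [Finset.mem_filter] at hv hv'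
        have hvv : v ∈ S ∩ S' := Finset.mem_inter.2 ⟨hv.1, hv'.1⟩
        have h1 := hv.2
        have h2 := hv'.2
        simp only [c, if_pos hvv] at h1 h2
        rcases le_total (a v) (b v) with h3 | h3
        · rw [min_eq_left h3, sub_self] at h1
          exact h1 rfl
        · rw [min_eq_right h3, sub_self] at h2
          exact h2 rfl)
      _ (hmem S _ hcS hmS) _ (hmem S' _ hcS' hmS')
    rw [← smul_sub, hxr, hyr, sub_sub_sub_cancel_right, norm_smul, norm_inv,
      Real.norm_of_nonneg hm0, inv_mul_eq_div, le_div_iff₀ h] at hdist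
    linarith
  have hmC : m * (1 + D) ≤ (1 + D) / δ * ‖x - y‖ := by
    rw [div_mul_eq_mul_div, le_div_iff₀ hδ0]
    nlinarith
  rcases (S ∩ S').eq_empty_or_nonempty with hemp | ⟨v₀, hv₀⟩
  · left
    have : m = 1 := by rw [hm, hemp]; simp
    rw [this] at hmC
    linarith
  · right
    have hv₀S := (Finset.mem_inter.1 hv₀).1
    have hv₀S' := (Finset.mem_inter.1 hv₀).2
    -- Both residuals are replaced by mass m at one shared vertex, which gives a point of the common
    -- face within m D of x and of y.
    set z := ∑ v ∈ S ∩ S', c v • v + m • v₀ with hz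
    have hzmem : z ∈ hull (S ∩ S') := by
      rw [hull, Finset.mem_convexHull']
      refine ⟨fun v => c v + if v = v₀ then m else 0, fun v hv => ?_, ?_, ?_⟩
      · refine add_nonneg (hcpos v hv) ?_
        split_ifs
        · exact hm0
        · exact le_rfl
      · rw [Finset.sum_add_distrib, Finset.sum_ite_eq' , if_pos hv₀, hm]
        ring
      · simp_rw [add_smul, Finset.sum_add_distrib, ite_smul, zero_smul]
        rw [Finset.sum_ite_eq' (S ∩ S') v₀ (fun v => m • v), if_pos hv₀]
    refine ⟨z, ⟨hull_mono Finset.inter_subset_left hzmem,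
      hull_mono Finset.inter_subset_right hzmem⟩, ?_, ?_⟩
    · have h1 := norm_sum_smul_sub_le S (fun v => a v - c v) v₀ hcS
        (fun v hv => hD v (Finset.mem_union_left _ hv) v₀ (Finset.mem_union_left _ hv₀S)) hmS
      rw [hxr, sub_sub, ← hz] at h1
      linarith
    · have h1 := norm_sum_smul_sub_le S' (fun v => b v - c v) v₀ hcS'
        (fun v hv => hD v (Finset.mem_union_right _ hv) v₀ (Finset.mem_union_left _ hv₀S)) hmS'
      rw [hyr, sub_sub, ← hz, norm_sub_rev] at h1
      linarith

theorem polyFun_lipschitz {u : Pt d → ℝ} (hu : u ∈ polyFun d ℓ) (S : Finset (Pt d)) :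
    ∃ K : ℝ, 0 ≤ K ∧ ∀ x ∈ hull S, ∀ y ∈ hull S, ‖u x - u y‖ ≤ K * ‖x - y‖ := by
  obtain ⟨K, hK⟩ := ((polyFun_contDiff hu).of_le (m := 1)
    (by exact_mod_cast le_top)).contDiffOn.exists_lipschitzOnWith one_ne_zero
    (convex_convexHull ℝ (S : Set (Pt d))) (hull_isCompact S)
  refine ⟨K, K.2, fun x hx y hy => ?_⟩
  have := hK.dist_le_mul x hx y hy
  rwa [dist_eq_norm, dist_eq_norm] at this

variable {Ω : PolytopalDomain d} (T : Triangulation Ω) {γ : Set (Pt d)}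

-- The closed domain need not be convex, so local bounds do not integrate along segments. Instead,
-- two points of different cells are either joined through a point of the common face at comparable
-- length, or are far enough apart for boundedness of `u` to suffice.
open Filter in
theorem Triangulation.exists_lipschitzOn {u : Pt d → ℝ}
    (hu : ∀ S ∈ T.cells, ∃ p ∈ polyFun d ℓ, ∀ x ∈ hull S, u x = p x) :
    ∃ K, LipschitzOnWith K u (closure Ω.carrier) := by
  have hloc : ∀ S ∈ T.cells, ∃ K : ℝ, 0 ≤ K ∧
      ∀ x ∈ hull S, ∀ y ∈ hull S, ‖u x - u y‖ ≤ K * ‖x - y‖ := by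
    intro S hS
    obtain ⟨p, hp, hup⟩ := hu S hS
    obtain ⟨K, hK0, hK⟩ := polyFun_lipschitz hp S
    exact ⟨K, hK0, fun x hx y hy => by rw [hup x hx, hup y hy]; exact hK x hx y hy⟩
  have hbd : ∀ S ∈ T.cells, ∃ A : ℝ, ∀ x ∈ hull S, ‖u x‖ ≤ A := by
    intro S hS
    obtain ⟨p, hp, hup⟩ := hu S hS
    obtain ⟨A, hA⟩ := (hull_isCompact S).exists_bound_of_continuousOn
      (polyFun_continuous hp).continuousOn
    exact ⟨A, fun x hx => by rw [hup x hx]; exact hA x hx⟩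
  have h : ∀ᶠ K : ℝ in atTop, ∀ S ∈ T.cells, ∀ S' ∈ T.cells, ∀ x ∈ hull S, ∀ y ∈ hull S',
      ‖u x - u y‖ ≤ K * ‖x - y‖ := by
    rw [eventually_all_finset]
    intro S hS
    rw [eventually_all_finset]
    intro S' hS'
    obtain ⟨C, hC0, hC⟩ := exists_regularly_situated (T.affineIndependent S hS)
      (T.affineIndependent S' hS') (T.conforming S hS S' hS')
    obtain ⟨K, hK0, hK⟩ := hloc S hS
    obtain ⟨K', hK'0, hK'⟩ := hloc S' hS'
    obtain ⟨A, hA⟩ := hbd S hS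
    obtain ⟨A', hA'⟩ := hbd S' hS'
    filter_upwards [eventually_ge_atTop ((A + A') * C), eventually_ge_atTop ((K + K') * C)]
      with M hM1 hM2 x hx y hy
    rcases hC x hx y hy with h | ⟨z, ⟨hz, hz'⟩, h1, h2⟩
    · have hAA : 0 ≤ A + A' := add_nonneg ((norm_nonneg _).trans (hA x hx))
        ((norm_nonneg _).trans (hA' y hy))
      calc ‖u x - u y‖ ≤ ‖u x‖ + ‖u y‖ := norm_sub_le _ _
        _ ≤ (A + A') * 1 := by linarith [hA x hx, hA' y hy]
        _ ≤ (A + A') * (C * ‖x - y‖) := by gcongr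
        _ = (A + A') * C * ‖x - y‖ := by ring
        _ ≤ M * ‖x - y‖ := by gcongr
    · calc ‖u x - u y‖ ≤ ‖u x - u z‖ + ‖u z - u y‖ := norm_sub_le_norm_sub_add_norm_sub _ _ _
        _ ≤ K * ‖x - z‖ + K' * ‖z - y‖ := add_le_add (hK x hx z hz) (hK' z hz' y hy)
        _ ≤ K * (C * ‖x - y‖) + K' * (C * ‖x - y‖) := by gcongr
        _ = (K + K') * C * ‖x - y‖ := by ring
        _ ≤ M * ‖x - y‖ := by gcongr
  obtain ⟨K, hK, hK0⟩ := (h.and (eventually_ge_atTop 0)).exists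
  refine ⟨⟨K, hK0⟩, LipschitzOnWith.of_dist_le_mul fun x hx y hy => ?_⟩
  rw [← T.cover] at hx hy
  simp only [mem_iUnion, exists_prop] at hx hy
  obtain ⟨S, hS, hx⟩ := hx
  obtain ⟨S', hS', hy⟩ := hy
  rw [dist_eq_norm, dist_eq_norm]
  exact hK S hS S' hS' x hx y hy

/-! ### The nodal basis -/

/-- By conformity two cells meet within the hull of their shared vertices, whose nodes are nodes of
both; unisolvence on that face makes the two interpolants agree there. -/
theorem Triangulation.exists_glue (hℓ : ℓ ≠ 0) (c : Pt d → ℝ) :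
    ∃ u : Pt d → ℝ, (∀ x ∉ closure Ω.carrier, u x = 0) ∧ ∀ S ∈ T.cells,
      (∃ p ∈ polyFun d ℓ, ∀ x ∈ hull S, u x = p x) ∧ ∀ ν ∈ nodes S ℓ, u ν = c ν := by
  classical
  choose! P hP hPc using fun S (hS : S ∈ T.cells) => (T.isSimplex hS).exists_interp hℓ c
  have hcons : ∀ S ∈ T.cells, ∀ S' ∈ T.cells, ∀ x ∈ hull S, x ∈ hull S' → P S x = P S' x := by
    intro S hS S' hS' x hx hx'
    have h1 := T.conforming S hS S' hS' ⟨hx, hx'⟩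
    rw [← Finset.coe_inter] at h1
    refine sub_eq_zero.1 (polyFun_eq_zero_of_nodes hℓ (S ∩ S')
      ((polyFun d ℓ).sub_mem (hP S hS) (hP S' hS')) (fun ν hν => ?_) h1)
    rw [Pi.sub_apply, hPc S hS ν (nodes_mono Finset.inter_subset_left hν),
      hPc S' hS' ν (nodes_mono Finset.inter_subset_right hν), sub_self]
  let u : Pt d → ℝ := fun x => if h : ∃ S ∈ T.cells, x ∈ hull S then P h.choose x else 0
  have hu : ∀ S ∈ T.cells, ∀ x ∈ hull S, u x = P S x := by
    intro S hS x hx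
    have h : ∃ S ∈ T.cells, x ∈ hull S := ⟨S, hS, hx⟩
    have h1 : u x = P h.choose x := dif_pos h
    rw [h1]
    exact hcons _ h.choose_spec.1 S hS x h.choose_spec.2 hx
  refine ⟨u, fun x hx => dif_neg ?_, fun S hS => ⟨⟨P S, hP S hS, hu S hS⟩, fun ν hν => ?_⟩⟩
  · rintro ⟨S, hS, hxS⟩
    exact hx (T.hull_subset hS hxS)
  · rw [hu S hS ν (nodes_subset_hull hℓ hν), hPc S hS ν hν]

theorem Triangulation.mem_lagrangeNodes {ν : Pt d} :
    ν ∈ T.lagrangeNodes γ ℓ ↔ (∃ S ∈ T.cells, ν ∈ nodes S ℓ) ∧ ν ∉ γ := by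
  classical
  simp [Triangulation.lagrangeNodes, nodes]

/-- The glued function vanishes on all of γ, and not merely at its nodes, by unisolvence on each
face composing γ; being Lipschitz, it is then in H¹_{0,γ}. -/
theorem Triangulation.exists_mem_feSpace (hℓ : ℓ ≠ 0) (hγ : T.IsBoundaryPart γ) {c : Pt d → ℝ}
    (hc : ∀ x ∈ γ, c x = 0) :
    ∃ u ∈ T.feSpace γ ℓ, ∀ S ∈ T.cells, ∀ ν ∈ nodes S ℓ, u ν = c ν := by
  obtain ⟨u, hu0, hu⟩ := T.exists_glue hℓ c
  obtain ⟨K, hK⟩ := T.exists_lipschitzOn fun S hS => (hu S hS).1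
  have huγ : ∀ x ∈ γ, u x = 0 := by
    obtain ⟨-, fs, hfs, hγf⟩ := hγ
    intro x hx
    rw [hγf] at hx
    simp only [mem_iUnion, exists_prop] at hx
    obtain ⟨f, hf, hxf⟩ := hx
    obtain ⟨-, S, hS, hfS⟩ := hfs f hf
    have hfγ : hull f ⊆ γ := by
      rw [hγf]
      exact subset_biUnion_of_mem (u := fun S => hull S) (Finset.mem_coe.2 hf)
    obtain ⟨⟨p, hp, hup⟩, huc⟩ := hu S hS
    rw [hup x (hull_mono hfS hxf)]
    refine polyFun_eq_zero_of_nodes hℓ f hp (fun ν hν => ?_) hxf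
    have hνf := nodes_subset_hull hℓ hν
    rw [← hup ν (hull_mono hfS hνf), huc ν (nodes_mono hfS hν), hc ν (hfγ hνf)]
  refine ⟨u, ⟨hK.continuousOn, hu0, fun S hS => ?_,
    exists_mem_H10_of_lipschitzOn hK hγ.subset_closure huγ⟩, fun S hS => (hu S hS).2⟩
  obtain ⟨⟨q, ⟨p, hp, hpq⟩, huq⟩, -⟩ := hu S hS
  exact ⟨p, hp, fun x hx => (huq x hx).trans (hpq x)⟩

/-- The nodes on γ are supplied by the trace argument `eq_zero_on_of_mem_H10`; unisolvence on each
cell does the rest. -/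
theorem Triangulation.feSpace_eq_zero (hℓ : ℓ ≠ 0) (hγ : T.IsBoundaryPart γ) {u : Pt d → ℝ}
    (hu : u ∈ T.feSpace γ ℓ) (h0 : ∀ ν ∈ T.lagrangeNodes γ ℓ, u ν = 0) : u = 0 := by
  obtain ⟨hc, hu0, hp, F, hF, hFu⟩ := hu
  funext x
  by_cases hx : x ∈ closure Ω.carrier
  · rw [← T.cover] at hx
    simp only [mem_iUnion, exists_prop] at hx
    obtain ⟨S, hS, hxS⟩ := hx
    obtain ⟨p, hpd, hup⟩ := hp S hS
    have hpf : (fun x : Pt d => MvPolynomial.eval (fun i => x i) p) ∈ polyFun d ℓ :=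
      ⟨p, hpd, fun _ => rfl⟩
    rw [hup x hxS]
    refine polyFun_eq_zero_of_nodes hℓ S hpf (fun ν hν => ?_) hxS
    rw [← hup ν (nodes_subset_hull hℓ hν)]
    by_cases hνγ : ν ∈ γ
    · exact eq_zero_on_of_mem_H10 T hγ hc hF hFu hνγ
    · exact h0 ν (T.mem_lagrangeNodes.2 ⟨⟨S, hS, hν⟩, hνγ⟩)
  · exact hu0 x hx

open Classical in
/-- The nodal basis of the finite element space. -/
theorem Triangulation.exists_nodal_basis (hℓ : ℓ ≠ 0) (hγ : T.IsBoundaryPart γ) (s : ℝ) :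
    ∃ φ : Module.Basis (T.lagrangeNodes γ ℓ) ℝ (T.V2 γ ℓ s),
      ∀ ν : T.lagrangeNodes γ ℓ, ∀ S ∈ T.cells, ∀ ν' ∈ nodes S ℓ,
        φ ν ν' = if (ν : Pt d) = ν' then 1 else 0 := by
  have hex : ∀ ν : T.lagrangeNodes γ ℓ, ∃ u : T.V2 γ ℓ s, ∀ S ∈ T.cells, ∀ ν' ∈ nodes S ℓ,
      u ν' = if (ν : Pt d) = ν' then 1 else 0 := by
    intro ν
    obtain ⟨u, hu, huc⟩ := T.exists_mem_feSpace hℓ hγ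
      (c := fun x => if (ν : Pt d) = x then 1 else 0) (fun x hx => by
        refine if_neg fun h => ?_
        exact (T.mem_lagrangeNodes.1 ν.2).2 (h ▸ hx))
    exact ⟨⟨u, hu⟩, huc⟩
  choose φ hφ using hex
  have hval : ∀ (c : T.lagrangeNodes γ ℓ → ℝ) (x : Pt d),
      (∑ ν, c ν • φ ν : T.V2 γ ℓ s) x = ∑ ν, c ν * φ ν x := by
    intro c x
    have h1 : ((∑ ν, c ν • φ ν : T.V2 γ ℓ s) : Pt d → ℝ) = ∑ ν, c ν • (φ ν : Pt d → ℝ) :=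
      (map_sum (T.feSpace γ ℓ).subtype (fun ν => c ν • φ ν) Finset.univ)
    rw [h1, Finset.sum_apply]
    rfl
  have hnode : ∀ (c : T.lagrangeNodes γ ℓ → ℝ) (ν' : T.lagrangeNodes γ ℓ),
      (∑ ν, c ν • φ ν : T.V2 γ ℓ s) (ν' : Pt d) = c ν' := by
    intro c ν'
    obtain ⟨⟨S, hS, hν'⟩, -⟩ := T.mem_lagrangeNodes.1 ν'.2
    rw [hval]
    simp [hφ _ S hS _ hν']
  have hrep : ∀ u : T.V2 γ ℓ s, u = ∑ ν : T.lagrangeNodes γ ℓ, u (ν : Pt d) • φ ν := by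
    intro u
    have h1 : (u - ∑ ν : T.lagrangeNodes γ ℓ, u (ν : Pt d) • φ ν : T.V2 γ ℓ s) = 0 := by
      refine Subtype.ext (T.feSpace_eq_zero hℓ hγ (Subtype.prop _) fun ν hν => ?_)
      change u ν - (∑ ν : T.lagrangeNodes γ ℓ, u (ν : Pt d) • φ ν : T.V2 γ ℓ s) ν = 0
      rw [hnode _ ⟨ν, hν⟩, sub_self]
    exact sub_eq_zero.1 h1
  have hli : LinearIndependent ℝ φ := by
    rw [Fintype.linearIndependent_iff]
    intro c hc ν
    rw [← hnode c ν, hc]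
    rfl
  refine ⟨Module.Basis.mk hli fun u _ => ?_, ?_⟩
  · rw [hrep u]
    exact Submodule.sum_mem _ fun ν _ => Submodule.smul_mem _ _
      (Submodule.subset_span (mem_range_self ν))
  · simpa only [Module.Basis.mk_apply] using hφ

end

section

variable {d ℓ : ℕ}

/-! ### Decomposition of the norm -/

theorem IsSimplex.eq_of_interior_hull_nonempty {S R : Finset (Pt d)} (hS : IsSimplex S)
    (hR : R ⊆ S) (h : (interior (hull R)).Nonempty) : R = S := by
  rw [hull, interior_convexHull_nonempty_iff_affineSpan_eq_top] at h
  have hRi : AffineIndependent ℝ ((↑) : R → Pt d) :=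
    hS.affineIndependent.mono (by exact_mod_cast hR)
  have h1 := (hRi.affineSpan_eq_top_iff_card_eq_finrank_add_one).1 (by simpa using h)
  refine Finset.eq_of_subset_of_card_le hR ?_
  rw [hS.card_eq]
  simpa using h1.ge

variable {Ω : PolytopalDomain d} (T : Triangulation Ω) {γ : Set (Pt d)} {s : ℝ}

/-- An overlap with interior would lie in the hull of the shared vertices, which has interior only
if all vertices are shared. -/
theorem Triangulation.disjoint_interior {S S' : Finset (Pt d)} (hS : S ∈ T.cells)
    (hS' : S' ∈ T.cells) (hne : S ≠ S') : Disjoint (interior (hull S)) (interior (hull S')) := by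
  classical
  rw [Set.disjoint_iff_inter_eq_empty, ← Set.not_nonempty_iff_eq_empty, ← interior_inter]
  intro h
  have hconf := T.conforming S hS S' hS'
  rw [← Finset.coe_inter] at hconf
  have h2 : (interior (hull (S ∩ S'))).Nonempty := h.mono (interior_mono hconf)
  refine hne ?_
  rw [← (T.isSimplex hS).eq_of_interior_hull_nonempty Finset.inter_subset_left h2]
  exact (T.isSimplex hS').eq_of_interior_hull_nonempty Finset.inter_subset_right h2

theorem interior_hull_ae_eq (S : Finset (Pt d)) :
    interior (hull S) =ᵐ[volume] hull S :=
  interior_ae_eq_of_null_frontier ((convex_convexHull ℝ _).addHaar_frontier volume)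

theorem Triangulation.carrier_ae_eq :
    Ω.carrier =ᵐ[volume] ⋃ S ∈ T.cells, interior (hull S) := by
  refine Filter.EventuallyLE.antisymm ?_ ?_
  · have h0 : ∀ᵐ x : Pt d, ∀ S ∈ T.cells, x ∉ frontier (hull S) := by
      rw [Finset.eventually_all]
      intro S _
      exact measure_eq_zero_iff_ae_notMem.1 ((convex_convexHull ℝ _).addHaar_frontier volume)
    filter_upwards [h0] with x hx hxΩ
    have h1 : x ∈ ⋃ S ∈ T.cells, hull S := T.cover ▸ subset_closure hxΩ
    simp only [mem_iUnion, exists_prop] at h1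
    obtain ⟨S, hS, hxS⟩ := h1
    have hint : x ∈ interior (hull S) := by
      by_contra h
      exact hx S hS ⟨subset_closure hxS, h⟩
    exact mem_biUnion (Finset.mem_coe.2 hS) hint
  · exact LE.le.eventuallyLE (iUnion₂_subset fun S hS => T.interior_hull_subset hS)

theorem Triangulation.meshSize_eq {S : Finset (Pt d)} (hS : S ∈ T.cells) {x : Pt d}
    (hx : x ∈ interior (hull S)) : T.meshSize x = cellSize S := by
  rw [Triangulation.meshSize, Finset.sum_eq_single S]
  · exact indicator_of_mem hx _
  · intro S' hS' hne
    exact indicator_of_notMem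
      (Set.disjoint_left.1 (T.disjoint_interior hS hS' hne.symm) hx) _
  · exact fun h => absurd hS h

/-- Cell boundaries are null sets and the mesh size is constant inside each cell, so the weight
becomes one scalar per cell. It multiplies both sides of every local comparison, which is why s does
not affect the constants. -/
theorem Triangulation.norm_sq_eq (u : T.V2 γ ℓ s) :
    ‖u‖ ^ 2 = ∑ S ∈ T.cells, (cellSize S ^ (-s)) ^ 2 * ∫ x in hull S, u x ^ 2 := by
  have hn : ‖u‖ ^ 2 = ∫ x in Ω.carrier, (T.meshSize x ^ (-s) * u x) ^ 2 :=
    norm_toLp_sq (T.memLp_scaled s u)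
  have hint : IntegrableOn (fun x => (T.meshSize x ^ (-s) * u x) ^ 2) Ω.carrier :=
    (T.memLp_scaled s u).integrable_sq
  rw [hn, setIntegral_congr_set T.carrier_ae_eq, integral_biUnion_finset _
    (fun S _ => isOpen_interior.measurableSet)
    (fun S hS S' hS' hne => T.disjoint_interior hS hS' hne)
    (fun S hS => hint.mono_set (T.interior_hull_subset hS))]
  refine Finset.sum_congr rfl fun S hS => ?_
  rw [← setIntegral_congr_set (interior_hull_ae_eq S), ← integral_const_mul]
  refine setIntegral_congr_fun isOpen_interior.measurableSet fun x hx => ?_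
  simp only [T.meshSize_eq hS hx, mul_pow]

/-! ### Equivalence of the norm and the weighted nodal norm -/

-- The nodes of a cell that lie on γ contribute nothing, since `u` vanishes there by the trace
-- argument.
open Classical in
theorem Triangulation.sum_lagrangeNodes (hγ : T.IsBoundaryPart γ) (u : T.V2 γ ℓ s)
    {S : Finset (Pt d)} (hS : S ∈ T.cells) :
    ∑ ν : T.lagrangeNodes γ ℓ, (if (ν : Pt d) ∈ nodes S ℓ then u ν ^ 2 else 0) =
      ∑ ν ∈ nodes S ℓ, u ν ^ 2 := by
  rw [Finset.sum_coe_sort (T.lagrangeNodes γ ℓ) (fun ν => if ν ∈ nodes S ℓ then u ν ^ 2 else 0),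
    ← Finset.sum_filter]
  refine Finset.sum_subset (fun ν hν => (Finset.mem_filter.1 hν).2) fun ν hν hν' => ?_
  have hνγ : ν ∈ γ := by
    by_contra h
    exact hν' (Finset.mem_filter.2 ⟨T.mem_lagrangeNodes.2 ⟨⟨S, hS, hν⟩, h⟩, hν⟩)
  obtain ⟨hc, -, -, F, hF, hFu⟩ := u.2
  have : u ν = 0 := eq_zero_on_of_mem_H10 T hγ hc hF hFu hνγ
  rw [this]
  norm_num

theorem Triangulation.exists_polyFun (u : T.V2 γ ℓ s) {S : Finset (Pt d)} (hS : S ∈ T.cells) :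
    ∃ p ∈ polyFun d ℓ, ∀ x ∈ hull S, u x = p x := by
  obtain ⟨p, hp, hup⟩ := u.2.2.2.1 S hS
  exact ⟨fun x => MvPolynomial.eval (fun i => x i) p, ⟨p, hp, fun _ => rfl⟩, hup⟩

/-- The constant in the equivalence does not depend on the triangulation. -/
theorem exists_nodal_norm_equiv (d : ℕ) {ℓ : ℕ} (hℓ : ℓ ≠ 0) :
    ∃ C : ℝ, 0 < C ∧ ∀ (Ω : PolytopalDomain d) (T : Triangulation Ω) (γ : Set (Pt d)) (s : ℝ),
      T.IsBoundaryPart γ → ∀ φ : T.lagrangeNodes γ ℓ → T.V2 γ ℓ s,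
      (∀ ν : T.lagrangeNodes γ ℓ, ∀ S ∈ T.cells, ∀ ν' ∈ nodes S ℓ, ν' ≠ ν → φ ν ν' = 0) →
      (∀ ν : T.lagrangeNodes γ ℓ, φ ν (ν : Pt d) = 1) → ∀ u : T.V2 γ ℓ s,
        ∑ ν, ‖φ ν‖ ^ 2 * u (ν : Pt d) ^ 2 ≤ C * ‖u‖ ^ 2 ∧
        ‖u‖ ^ 2 ≤ C * ∑ ν, ‖φ ν‖ ^ 2 * u (ν : Pt d) ^ 2 := by
  classical
  obtain ⟨C, hC, hCS⟩ := exists_uniform_norm_equiv d hℓ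
  -- On each cell the local equivalence is used twice, once for `u` and once for the basis
  -- functions, hence the square.
  refine ⟨C ^ 2, by positivity, fun Ω T γ s hγ φ hφ0 hφ1 u => ?_⟩
  have hloc : ∀ (w : T.V2 γ ℓ s), ∀ S ∈ T.cells,
      volume.real (hull S) * ∑ ν ∈ nodes S ℓ, w ν ^ 2 ≤ C * ∫ x in hull S, w x ^ 2 ∧
      ∫ x in hull S, w x ^ 2 ≤ C * (volume.real (hull S) * ∑ ν ∈ nodes S ℓ, w ν ^ 2) := by
    intro w S hS
    obtain ⟨p, hp, hwp⟩ := T.exists_polyFun w hS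
    have h := hCS S (T.isSimplex hS) p hp
    have e1 : ∑ ν ∈ nodes S ℓ, w ν ^ 2 = ∑ ν ∈ nodes S ℓ, p ν ^ 2 :=
      Finset.sum_congr rfl fun ν hν => by rw [hwp ν (nodes_subset_hull hℓ hν)]
    have e2 : ∫ x in hull S, w x ^ 2 = ∫ x in hull S, p x ^ 2 :=
      setIntegral_congr_fun (hull_measurableSet S) fun x hx => by simp only [hwp x hx]
    rw [e1, e2]
    exact h
  have hφn : ∀ (ν : T.lagrangeNodes γ ℓ), ∀ S ∈ T.cells,
      ∑ ν' ∈ nodes S ℓ, φ ν ν' ^ 2 = if (ν : Pt d) ∈ nodes S ℓ then 1 else 0 := by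
    intro ν S hS
    rw [← Finset.sum_ite_eq' (nodes S ℓ) (ν : Pt d) (fun _ => (1 : ℝ))]
    refine Finset.sum_congr rfl fun ν' hν' => ?_
    split_ifs with h
    · rw [h, hφ1, one_pow]
    · rw [hφ0 ν S hS ν' hν' h]
      norm_num
  have hE : ∑ ν, ‖φ ν‖ ^ 2 * u (ν : Pt d) ^ 2 = ∑ S ∈ T.cells, (cellSize S ^ (-s)) ^ 2 *
      ∑ ν : T.lagrangeNodes γ ℓ, (∫ x in hull S, φ ν x ^ 2) * u (ν : Pt d) ^ 2 := by
    simp_rw [T.norm_sq_eq, Finset.sum_mul, Finset.mul_sum]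
    rw [Finset.sum_comm]
    simp_rw [mul_assoc]
  -- The nodal sum of φ_ν² over S is 1 if ν is a node of S and 0 otherwise. So the local nodal norm
  -- of `u` is the diagonal form with the integral of each φ_ν² replaced by its nodal counterpart.
  have hV : ∀ S ∈ T.cells, volume.real (hull S) * ∑ ν ∈ nodes S ℓ, u ν ^ 2 =
      ∑ ν : T.lagrangeNodes γ ℓ, (volume.real (hull S) * ∑ ν' ∈ nodes S ℓ, φ ν ν' ^ 2) *
        u (ν : Pt d) ^ 2 := by
    intro S hS
    rw [← T.sum_lagrangeNodes hγ u hS, Finset.mul_sum]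
    refine Finset.sum_congr rfl fun ν _ => ?_
    rw [hφn ν S hS]
    split_ifs <;> ring
  rw [hE, T.norm_sq_eq u, Finset.mul_sum, Finset.mul_sum]
  constructor
  · refine Finset.sum_le_sum fun S hS => ?_
    rw [mul_left_comm]
    refine mul_le_mul_of_nonneg_left ?_ (sq_nonneg _)
    calc ∑ ν : T.lagrangeNodes γ ℓ, (∫ x in hull S, φ ν x ^ 2) * u (ν : Pt d) ^ 2
        ≤ ∑ ν : T.lagrangeNodes γ ℓ,
          C * (volume.real (hull S) * ∑ ν' ∈ nodes S ℓ, φ ν ν' ^ 2) * u (ν : Pt d) ^ 2 :=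
          Finset.sum_le_sum fun ν _ =>
            mul_le_mul_of_nonneg_right (hloc (φ ν) S hS).2 (sq_nonneg _)
      _ = C * (volume.real (hull S) * ∑ ν ∈ nodes S ℓ, u ν ^ 2) := by
          rw [hV S hS, Finset.mul_sum]
          simp_rw [mul_assoc]
      _ ≤ C * (C * ∫ x in hull S, u x ^ 2) :=
          mul_le_mul_of_nonneg_left (hloc u S hS).1 hC.le
      _ = _ := by ring
  · refine Finset.sum_le_sum fun S hS => ?_
    rw [mul_left_comm]
    refine mul_le_mul_of_nonneg_left ?_ (sq_nonneg _)
    calc ∫ x in hull S, u x ^ 2 ≤ C * (volume.real (hull S) * ∑ ν ∈ nodes S ℓ, u ν ^ 2) :=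
          (hloc u S hS).2
      _ = C * ∑ ν : T.lagrangeNodes γ ℓ,
          (volume.real (hull S) * ∑ ν' ∈ nodes S ℓ, φ ν ν' ^ 2) * u (ν : Pt d) ^ 2 := by
          rw [hV S hS]
      _ ≤ C * ∑ ν : T.lagrangeNodes γ ℓ, (C * ∫ x in hull S, φ ν x ^ 2) * u (ν : Pt d) ^ 2 := by
          refine mul_le_mul_of_nonneg_left (Finset.sum_le_sum fun ν _ => ?_) hC.le
          exact mul_le_mul_of_nonneg_right (hloc (φ ν) S hS).1 (sq_nonneg _)
      _ = _ := by
          simp_rw [mul_assoc]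
          rw [← Finset.mul_sum]
          ring

/-! ### Symmetric coercive operators -/

section Operators

variable {Y : Type*} [NormedAddCommGroup Y] [NormedSpace ℝ Y] [FiniteDimensional ℝ Y]

theorem finrank_strongDual : Module.finrank ℝ (StrongDual ℝ Y) = Module.finrank ℝ Y :=
  (LinearMap.toContinuousLinearMap (𝕜 := ℝ) (E := Y) (F' := ℝ)).finrank_eq.symm.trans
    Subspace.dual_finrank_eq

/-- An injective operator into the dual of a finite dimensional space is invertible. -/
def equivOfInjective (R : Y →L[ℝ] StrongDual ℝ Y) (hR : Function.Injective R) :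
    Y ≃L[ℝ] StrongDual ℝ Y :=
  (LinearMap.linearEquivOfInjective (R : Y →ₗ[ℝ] StrongDual ℝ Y) hR
    finrank_strongDual.symm).toContinuousLinearEquiv

variable (Y) in
/-- The canonical isomorphism with the bidual. -/
def bidualEquiv : Y ≃L[ℝ] StrongDual ℝ (StrongDual ℝ Y) :=
  (LinearMap.linearEquivOfInjective
    (NormedSpace.inclusionInDoubleDual ℝ Y : Y →ₗ[ℝ] StrongDual ℝ (StrongDual ℝ Y))
    (NormedSpace.inclusionInDoubleDualLi ℝ (E := Y)).injective
    (finrank_strongDual.symm.trans finrank_strongDual.symm)).toContinuousLinearEquiv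

theorem norm_bidualEquiv (y : Y) : ‖bidualEquiv Y y‖ = ‖y‖ :=
  (NormedSpace.inclusionInDoubleDualLi ℝ (E := Y)).norm_map y

/-- The inverse of a symmetric, bounded and coercive operator. -/
theorem isLiscWith_symm {R : Y ≃L[ℝ] StrongDual ℝ Y} {C₁ C₂ K : ℝ} (hC₂ : 0 < C₂)
    (hsymm : ∀ u w, R u w = R w u) (hcs : ∀ u w, R u w ^ 2 ≤ R u u * R w w)
    (h1 : ∀ u, ‖u‖ ^ 2 ≤ C₁ * R u u) (h2 : ∀ u, R u u ≤ C₂ * ‖u‖ ^ 2)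
    (hC₁ : 0 ≤ C₁) (hK1 : C₁ ≤ K) (hK2 : C₂ ≤ K) :
    IsLiscWith K (toBidual (R.symm : StrongDual ℝ Y →L[ℝ] Y)) := by
  have hpos : ∀ u, 0 ≤ R u u := fun u => by
    by_contra h
    have e := h1 u
    have : C₁ * R u u ≤ 0 := mul_nonpos_of_nonneg_of_nonpos hC₁ (not_le.1 h).le
    have hu : u = 0 := by
      have := sq_nonneg ‖u‖
      exact norm_eq_zero.1 (pow_eq_zero_iff two_ne_zero |>.1 (by linarith))
    simp [hu] at h
  -- Cauchy–Schwarz for the form of `R` controls the dual norm by the energy. At u = R⁻¹ f this is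
  -- precisely the coercivity of the inverse, with constant C₂⁻¹.
  have hdual : ∀ u, ‖R u‖ ^ 2 ≤ C₂ * R u u := by
    intro u
    have hle : ‖R u‖ ≤ Real.sqrt (C₂ * R u u) := by
      refine ContinuousLinearMap.opNorm_le_bound _ (Real.sqrt_nonneg _) fun w => ?_
      rw [Real.norm_eq_abs]
      refine abs_le_of_sq_le_sq ?_ (by positivity)
      rw [mul_pow, Real.sq_sqrt (mul_nonneg hC₂.le (hpos u))]
      calc R u w ^ 2 ≤ R u u * R w w := hcs u w
        _ ≤ R u u * (C₂ * ‖w‖ ^ 2) := mul_le_mul_of_nonneg_left (h2 w) (hpos u)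
        _ = _ := by ring
    calc ‖R u‖ ^ 2 ≤ Real.sqrt (C₂ * R u u) ^ 2 := by gcongr
      _ = _ := Real.sq_sqrt (mul_nonneg hC₂.le (hpos u))
  have hpair : ∀ u, R u u ≤ ‖R u‖ * ‖u‖ := fun u =>
    (le_abs_self _).trans ((R u).le_opNorm u)
  have hRle : ∀ u, ‖R u‖ ≤ C₂ * ‖u‖ := by
    intro u
    rcases (norm_nonneg (R u)).eq_or_lt with h | h
    · rw [← h]
      positivity
    · refine le_of_mul_le_mul_right ?_ h
      nlinarith [hdual u, hpair u, mul_le_mul_of_nonneg_left (hpair u) hC₂.le]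
  have hule : ∀ u, ‖u‖ ≤ C₁ * ‖R u‖ := by
    intro u
    rcases (norm_nonneg u).eq_or_lt with h | h
    · rw [← h]
      positivity
    · refine le_of_mul_le_mul_right ?_ h
      nlinarith [h1 u, hpair u, mul_le_mul_of_nonneg_left (hpair u) hC₁]
  set G := toBidual (R.symm : StrongDual ℝ Y →L[ℝ] Y) with hG
  have hGapp : ∀ f g, G f g = g (R.symm f) := fun f g => rfl
  let e : StrongDual ℝ Y ≃L[ℝ] StrongDual ℝ (StrongDual ℝ Y) := R.symm.trans (bidualEquiv Y)
  have hGe : G = (e : StrongDual ℝ Y →L[ℝ] StrongDual ℝ (StrongDual ℝ Y)) := rfl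
  -- By symmetry the real part is `G` itself, so its inverse has, up to the isometry with the
  -- bidual, the norm of `R`.
  have hreal : realPart G = G := by
    ext f g
    have e1 : G.flip f g = G f g := by
      rw [ContinuousLinearMap.flip_apply, hGapp, hGapp]
      have := hsymm (R.symm f) (R.symm g)
      rwa [R.apply_symm_apply, R.apply_symm_apply] at this
    change (1 / 2 : ℝ) * (G f g + G.flip f g) = G f g
    rw [e1]
    ring
  have hinv : G.IsInvertible := ⟨e, hGe.symm⟩
  refine ⟨⟨hinv, C₂⁻¹, inv_pos.2 hC₂, fun f => ?_⟩, ?_, ?_, ?_⟩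
  · have h := hdual (R.symm f)
    rw [R.apply_symm_apply] at h
    rw [hGapp, mul_assoc, inv_mul_le_iff₀ hC₂, ← sq]
    exact h
  · refine ContinuousLinearMap.opNorm_le_bound _ (hC₁.trans hK1) fun f => ?_
    have h := hule (R.symm f)
    rw [R.apply_symm_apply] at h
    calc ‖G f‖ = ‖R.symm f‖ := norm_bidualEquiv _
      _ ≤ C₁ * ‖f‖ := h
      _ ≤ K * ‖f‖ := by gcongr
  · rwa [hreal]
  · rw [hreal, hGe, ContinuousLinearMap.inverse_equiv]
    refine ContinuousLinearMap.opNorm_le_bound _ (hC₁.trans hK1) fun z => ?_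
    obtain ⟨y, rfl⟩ := (bidualEquiv Y).surjective z
    have : e.symm (bidualEquiv Y y) = R y := by
      rw [ContinuousLinearEquiv.symm_apply_eq]
      change bidualEquiv Y y = bidualEquiv Y (R.symm (R y))
      rw [R.symm_apply_apply]
    rw [ContinuousLinearEquiv.coe_coe, this, norm_bidualEquiv]
    exact (hRle y).trans (by gcongr)

end Operators

end

end FEM

end

/-! ### The uniform bounds for the inverse of the diagonal operator -/

theorem proposition6p2 (d ℓ : ℕ) (hd : 1 ≤ d) (hℓ : 2 ≤ ℓ) (β₂ σ : ℝ) (hβ₂ : 0 < β₂) :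
    ∃ C : ℝ, ∀ (Ω : FEM.PolytopalDomain d) (T : FEM.Triangulation Ω) (γ : Set (FEM.Pt d)) (s : ℝ),
      T.ShapeRegular σ → (d = 1 → T.KMesh σ) → T.IsBoundaryPart γ → s ∈ Set.Icc (0 : ℝ) 1 →
      ∃ φ : Module.Basis (T.lagrangeNodes γ ℓ) ℝ (T.V2 γ ℓ s),
        (∀ ν ν' : T.lagrangeNodes γ ℓ, φ ν (ν' : FEM.Pt d) = if ν = ν' then 1 else 0) ∧
        ∃ R : T.V2 γ ℓ s ≃L[ℝ] StrongDual ℝ (T.V2 γ ℓ s),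
          (∀ u w : T.V2 γ ℓ s,
            R u w = β₂⁻¹ * ∑ ν : T.lagrangeNodes γ ℓ,
              ‖φ ν‖ ^ 2 * u (ν : FEM.Pt d) * w (ν : FEM.Pt d)) ∧
          FEM.IsLiscWith C (FEM.toBidual
            (R.symm : StrongDual ℝ (T.V2 γ ℓ s) →L[ℝ] T.V2 γ ℓ s)) := by
  have hℓ0 : ℓ ≠ 0 := by omega
  obtain ⟨C, hC, hCT⟩ := FEM.exists_nodal_norm_equiv d hℓ0
  -- The first entry bounds the inverse, from ‖u‖² ≤ β₂ C (R u)(u); the second bounds `R`, from (R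
  -- u)(u) ≤ β₂⁻¹ C ‖u‖².
  refine ⟨max (β₂ * C) (β₂⁻¹ * C), fun Ω T γ s _ _ hγ _ => ?_⟩
  obtain ⟨φ, hφ⟩ := T.exists_nodal_basis hℓ0 hγ s
  have hφδ : ∀ ν ν' : T.lagrangeNodes γ ℓ, φ ν (ν' : FEM.Pt d) = if ν = ν' then 1 else 0 := by
    intro ν ν'
    obtain ⟨⟨S, hS, hν'⟩, -⟩ := T.mem_lagrangeNodes.1 ν'.2
    rw [hφ ν S hS ν' hν']
    simp only [Subtype.ext_iff]
  have hfin : FiniteDimensional ℝ (T.V2 γ ℓ s) := φ.finiteDimensional_of_finite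
  have hnorm := hCT Ω T γ s hγ φ (fun ν S hS ν' hν' hne => by
    rw [hφ ν S hS ν' hν', if_neg hne.symm]) (fun ν => by rw [hφδ, if_pos rfl])
  -- Point evaluation is bounded because the space has a finite basis; no uniform bound on it is
  -- needed.
  let ev : FEM.Pt d → StrongDual ℝ (T.V2 γ ℓ s) := fun ν => LinearMap.toContinuousLinearMap
    ((LinearMap.proj ν).comp (T.feSpace γ ℓ).subtype)
  have hev : ∀ ν (u : T.V2 γ ℓ s), ev ν u = u ν := fun ν u => rfl
  let R₀ : T.V2 γ ℓ s →L[ℝ] StrongDual ℝ (T.V2 γ ℓ s) :=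
    ∑ ν : T.lagrangeNodes γ ℓ, (ev ν).smulRight ((β₂⁻¹ * ‖φ ν‖ ^ 2) • ev ν)
  have hR₀ : ∀ u w : T.V2 γ ℓ s, R₀ u w = β₂⁻¹ * ∑ ν : T.lagrangeNodes γ ℓ,
      ‖φ ν‖ ^ 2 * u (ν : FEM.Pt d) * w (ν : FEM.Pt d) := by
    intro u w
    simp only [R₀, sum_apply, ContinuousLinearMap.smulRight_apply,
      smul_apply, smul_eq_mul, hev, Finset.mul_sum]
    exact Finset.sum_congr rfl fun ν _ => by ring
  have hdiag : ∀ u : T.V2 γ ℓ s, R₀ u u = β₂⁻¹ * ∑ ν : T.lagrangeNodes γ ℓ,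
      ‖φ ν‖ ^ 2 * u (ν : FEM.Pt d) ^ 2 := by
    intro u
    rw [hR₀]
    simp only [mul_assoc, sq]
  have hlow : ∀ u : T.V2 γ ℓ s, ‖u‖ ^ 2 ≤ β₂ * C * R₀ u u := by
    intro u
    rw [hdiag, mul_comm β₂ C, mul_assoc, mul_inv_cancel_left₀ hβ₂.ne']
    exact (hnorm u).2
  have hup : ∀ u : T.V2 γ ℓ s, R₀ u u ≤ β₂⁻¹ * C * ‖u‖ ^ 2 := by
    intro u
    rw [hdiag, mul_assoc]
    exact mul_le_mul_of_nonneg_left (hnorm u).1 (inv_nonneg.2 hβ₂.le)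
  have hinj : Function.Injective R₀ := by
    refine (injective_iff_map_eq_zero R₀).2 fun u hu => ?_
    have h := hlow u
    rw [hu, zero_apply, mul_zero] at h
    exact norm_eq_zero.1 (pow_eq_zero_iff two_ne_zero |>.1 (le_antisymm h (sq_nonneg _)))
  refine ⟨φ, hφδ, FEM.equivOfInjective R₀ hinj, hR₀, ?_⟩
  refine FEM.isLiscWith_symm (C₁ := β₂ * C) (C₂ := β₂⁻¹ * C) (by positivity) (fun u w => ?_)
    (fun u w => ?_) hlow hup (by positivity) (le_max_left _ _) (le_max_right _ _)
  · change R₀ u w = R₀ w u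
    rw [hR₀, hR₀]
    simp only [mul_right_comm]
  · change R₀ u w ^ 2 ≤ R₀ u u * R₀ w w
    rw [hdiag, hdiag, hR₀, mul_pow, mul_mul_mul_comm, ← sq]
    refine mul_le_mul_of_nonneg_left ?_ (sq_nonneg _)
    -- Cauchy–Schwarz for sums, with each weight ‖φ_ν‖² split evenly between the two factors.
    have h := Finset.sum_mul_sq_le_sq_mul_sq Finset.univ
      (fun ν : T.lagrangeNodes γ ℓ => ‖φ ν‖ * u (ν : FEM.Pt d))
      (fun ν : T.lagrangeNodes γ ℓ => ‖φ ν‖ * w (ν : FEM.Pt d))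
    simp only [mul_pow] at h
    convert h using 3 with ν
    ring
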